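/- For $n\ge 0$ and $0\le k\le n$ let layer $k$ consist of nodes $v_{k,1},\dots,v_{k,2^{n-k+1}-1}$, where layer $0$ is the input layer and layer $n$ is the single output node $v_{n,1}$. For $k\ge 1$ the children of $v_{k,i}$ are $v_{k-1,2i-1},v_{k-1,2i},v_{k-1,2i+1}$. Given filters $\theta_1,\dots,\theta_n\in\mathbb R^3$, the stride-2 convolutional iterated 3-majority network is the Boolean function $f_n:\{-1,1\}^{2^{n+1}-1}\to\{-1,1\}$ obtained by setting $f(v_{0,j})=\omega(j)$, $$f(v_{k,i})=\operatorname{sign}\Big(\sum_{j=1}^{3}\theta_k(j)\,f(v_{k-1,2i-2+j})\Big),\qquad 1\le k\le n,$$ and $f_n(\omega)=f(v_{n,1})$. Let $\omega$ be uniform on $\{-1,1\}^{2^{n+1}-1}$ and let $\omega^\epsilon$ be obtained from $\omega$ by flipping each bit independently with probability $\epsilon$. For every $n$ let $\theta_{n,1},\dots,\theta_{n,n}$ be independent random vectors in $\mathbb R^3$ (not necessarily identically distributed), independent of $(\omega,\omega^\epsilon)$, such that almost surely $\sum_{j}\theta_{n,t}(j)x_j\ne 0$ for all $x\in\{-1,1\}^3$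 (so that each filter expresses $\pm$ the 3-majority or $\pm$ a dictator). Assume that there is $p>0$ such that for all $n$ and all $1\le t\le n$, with probability at least $p$ the filter $\theta_{n,t}$ expresses a majority, i.e. $x\mapsto\operatorname{sign}(\sum_j\theta_{n,t}(j)x_j)$ is the 3-majority function on $\{-1,1\}^3$ or its negative. Let $\pi_n$ be the law of the random Boolean function $f_n$ with filters $\theta_{n,1},\dots,\theta_{n,n}$. Then $\{\pi_n\}$ is * quenched noise sensitive: for every $0<\epsilon\le 1/2$ and every $\delta>0$ there is $N$ such that for all $n\ge N$, $$\pi_n\{f:\operatorname{Cov}_{\omega,\omega^\epsilon}(f(\omega),f(\omega^\epsilon))\le\delta\}\ge 1-\delta;$$ * annealed noise sensitive: for every $0<\epsilon\le 1/2$, $$\lim_{n\to\infty}\operatorname{Cov}_{f_n,\omega,\omega^\epsilon}(f_n(\omega),f_n(\omega^\epsilon))=0,\qquad f_n\sim\pi_n .$$ -/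

import Mathlib

open MeasureTheory ProbabilityTheory Filter Topology

namespace NoiseNet

noncomputable section

/-! ### Boolean functions and noise -/

/-- Bit strings indexed by `ι`; a bit is an element of `ℤˣ = {1, -1}`. -/
abbrev Bits (ι : Type*) : Type _ := ι → ℤˣ

/-- Boolean functions `{-1, 1}^ι → {-1, 1}`. -/
abbrev BoolFun (ι : Type*) : Type _ := Bits ι → ℤˣ

/-- A bit as a real number. -/
def bitVal (b : ℤˣ) : ℝ := ((b : ℤ) : ℝ)

/-- The law of a random sign that is `-1` with probability `ε` and `1` with probability `1 - ε`. -/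
def coin (ε : ℝ) : Measure ℤˣ :=
  ENNReal.ofReal (1 - ε) • Measure.dirac 1 + ENNReal.ofReal ε • Measure.dirac (-1)

/-- The uniform distribution of the input `ω`: i.i.d. bits, each `±1` with probability `1/2`. -/
def uniformBits (ι : Type*) [Fintype ι] : Measure (Bits ι) :=
  Measure.pi fun _ => coin (1 / 2)

/-- The joint law of `(ω, ω^ε)`: `ω` is uniform and `ω^ε` is obtained from `ω` by flipping each bit
independently with probability `ε`. -/
def noisyPair (ι : Type*) [Fintype ι] (ε : ℝ) : Measure (Bits ι × Bits ι) :=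
  ((uniformBits ι).prod (Measure.pi fun _ => coin ε)).map fun q => (q.1, fun i => q.1 i * q.2 i)

/-- `Cov_{ω, ω^ε}(f(ω), f(ω^ε))` for a fixed Boolean function `f`. -/
def noiseCov {ι : Type*} [Fintype ι] (f : BoolFun ι) (ε : ℝ) : ℝ :=
  cov[fun q => bitVal (f q.1), fun q => bitVal (f q.2); noisyPair ι ε]

/-- `Cov_{f, ω, ω^ε}(f(ω), f(ω^ε))` where `f` has law `π` and is independent of `(ω, ω^ε)`. -/
def annealedNoiseCov {ι : Type*} [Fintype ι] (π : Measure (BoolFun ι)) (ε : ℝ) : ℝ :=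
  cov[fun q => bitVal (q.1 q.2.1), fun q => bitVal (q.1 q.2.2); π.prod (noisyPair ι ε)]

/-- Quenched noise sensitivity of a sequence `π n` of laws of random Boolean functions. -/
def QuenchedNoiseSensitive {ι : ℕ → Type*} [∀ n, Fintype (ι n)]
    (π : ∀ n, Measure (BoolFun (ι n))) : Prop :=
  ∀ ε : ℝ, 0 < ε → ε ≤ 1 / 2 → ∀ δ : ℝ, 0 < δ →
    ∃ N : ℕ, ∀ n ≥ N, 1 - δ ≤ (π n).real {f | noiseCov f ε ≤ δ}

/-- Annealed noise sensitivity of a sequence `π n` of laws of random Boolean functions. -/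
def AnnealedNoiseSensitive {ι : ℕ → Type*} [∀ n, Fintype (ι n)]
    (π : ∀ n, Measure (BoolFun (ι n))) : Prop :=
  ∀ ε : ℝ, 0 < ε → ε ≤ 1 / 2 → Tendsto (fun n => annealedNoiseCov (π n) ε) atTop (𝓝 0)

/-! ### The stride-2 convolutional network -/

/-- The sign activation. The value at `0` is a convention; it plays no role for filters without
ties. -/
def sgn (x : ℝ) : ℤˣ := if 0 ≤ x then 1 else -1

/-- The pre-activation `θ₀ x₀ + θ₁ x₁ + θ₂ x₂` of a filter with weights `θ`. -/
def preact (θ : Fin 3 → ℝ) (x : Bits (Fin 3)) : ℝ := ∑ i, θ i * bitVal (x i)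

/-- The weighted 3-majority with weights `θ`. -/
def weightedMaj (θ : Fin 3 → ℝ) : BoolFun (Fin 3) := fun x => sgn (preact θ x)

/-- The regular 3-majority, i.e. the weighted 3-majority with weights `(1, 1, 1)`. -/
def maj3 : BoolFun (Fin 3) := weightedMaj fun _ => 1

/-- The filter `θ` has no ties: its pre-activation never vanishes. -/
def NoTies (θ : Fin 3 → ℝ) : Prop := ∀ x : Bits (Fin 3), preact θ x ≠ 0

/-- The filter `θ` expresses a majority: the regular 3-majority or its negative. -/
def ExpressesMajority (θ : Fin 3 → ℝ) : Prop :=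
  (∀ x, weightedMaj θ x = maj3 x) ∨ (∀ x, weightedMaj θ x = -maj3 x)

/-- The positions in a layer with `m` layers above it: there are `2^(m+1) - 1` of them. -/
abbrev Layer (m : ℕ) : Type := Fin (2 ^ (m + 1) - 1)

/-- Child `j ∈ {0, 1, 2}` of node `i` in the next layer below: it has position `2 i + j`, counting
from `0` (that is, the children of node `i` are `2 i - 1`, `2 i`, `2 i + 1`, counting from `1`). -/
def child {m : ℕ} (i : Layer m) (j : Fin 3) : Layer (m + 1) :=
  ⟨2 * i.1 + j.1, by
    have hi := i.2
    have hj := j.2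
    have h : 2 ^ (m + 1 + 1) = 2 * 2 ^ (m + 1) := by ring
    omega⟩

/-- One convolutional layer with filter size 3 and stride 2 and no padding: the same filter `θ` is
applied to all triples of children. -/
def convLayer {m : ℕ} (θ : Fin 3 → ℝ) (x : Bits (Layer (m + 1))) : Bits (Layer m) :=
  fun i => weightedMaj θ fun j => x (child i j)

/-- The Boolean function of the stride-2 network of depth `n`. The filter `θ 0` is applied to the
input layer, then `θ 1`, and so on; `θ (n - 1)` yields the single output node. -/
def network : (n : ℕ) → (Fin n → Fin 3 → ℝ) → BoolFun (Layer n)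
  | 0, _ => fun ω => ω ⟨0, by norm_num⟩
  | n + 1, θ => fun ω => network n (Fin.tail θ) (convLayer (θ 0) ω)

/-- The law of the random Boolean function given by the network of depth `n` with random filters
`θ 0, …, θ (n - 1)`. -/
def networkLaw {Ω : Type*} [MeasurableSpace Ω] (P : Measure Ω) (n : ℕ)
    (θ : Fin n → Ω → Fin 3 → ℝ) : Measure (BoolFun (Layer n)) :=
  P.map fun w => network n fun t => θ t w

end

end NoiseNet

/-! Noise sensitivity follows from a randomized query algorithm with small revealment. In Fourier
terms the noise covariance is the sum of `(1 - 2ε)^d` times the level-`d` weight over `d ≥ 1`. By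
the Schramm–Steif inequality (`levelWeight_le`) that weight is at most `d * δ` as soon as some
algorithm computes the function while reading each bit with probability at most `δ`, and so the
covariance is at most `δ / ε^2` (`noiseCov_le`).

The algorithm descends from the output, replacing queried nodes by nodes below them. Across four
consecutive majority layers it can save something (`HasQueryRule.regular`). A random residue modulo
32 selects blocks of the lower row whose adjacent nodes are skipped whenever the remaining nodes
decide the queried value. If the eight even nodes of the parent block agree and match a suitable
neighbour, nothing near the selected block matters. Since filters without ties are odd, flipping
input pairs reaches this configuration by one of `2^8` sign patterns, and it does so without losing
the event that the parent block is touched. The touching probability therefore drops by the factor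
`1 - 1/(32 * 256) = 1 - 1/8192`. Other layers cost nothing.

A window of four layers consists of majorities with probability at least `p^4`, and disjoint windows
are independent, so the expected covariance is at most `(1 - p^4/8192)^(n/4) / ε^2`. Markov's
inequality gives the quenched statement. The annealed covariance equals the expected quenched one
because odd functions have mean zero. -/

namespace NoiseNet

set_option linter.unusedSectionVars false

/-! ### Walsh–Fourier analysis on the cube and the Schramm–Steif inequality. -/

section Fourier

open Finset
open scoped BigOperators

variable {ι : Type*} [Fintype ι] [DecidableEq ι]

/-- The Walsh character of a set of coordinates. -/
noncomputable def walsh (S : Finset ι) (x : Bits ι) : ℝ := ∏ i ∈ S, bitVal (x i)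

/-- The Fourier–Walsh coefficient of a real function on the cube. -/
noncomputable def walshCoeff (f : Bits ι → ℝ) (S : Finset ι) : ℝ := 𝔼 x, f x * walsh S x

theorem bitVal_mul (a b : ℤˣ) : bitVal (a * b) = bitVal a * bitVal b := by simp [bitVal]

theorem bitVal_neg (a : ℤˣ) : bitVal (-a) = -bitVal a := by simp [bitVal]

theorem bitVal_one : bitVal 1 = 1 := by simp [bitVal]

theorem bitVal_mul_self (a : ℤˣ) : bitVal a * bitVal a = 1 := by
  rw [← bitVal_mul, Int.units_mul_self, bitVal_one]

theorem abs_bitVal (a : ℤˣ) : |bitVal a| = 1 := by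
  rcases Int.units_eq_one_or a with rfl | rfl <;> simp [bitVal]

/-- The bit string with the single coordinate `i` flipped. -/
def flipAt (i : ι) (x : Bits ι) : Bits ι := Function.update x i (-x i)

theorem flipAt_involutive (i : ι) : Function.Involutive (flipAt (ι := ι) i) := by
  intro x; simp [flipAt]

theorem walsh_flipAt_of_mem {S : Finset ι} {i : ι} (hi : i ∈ S) (x : Bits ι) :
    walsh S (flipAt i x) = -walsh S x := by
  unfold walsh
  rw [← mul_prod_erase S _ hi, ← mul_prod_erase S (fun j => bitVal (x j)) hi, ← neg_mul]
  congr 1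
  · simp [flipAt, bitVal_neg]
  · refine prod_congr rfl fun j hj => ?_
    simp [flipAt, Function.update_of_ne (ne_of_mem_erase hj)]

theorem walsh_flipAt_of_notMem {S : Finset ι} {i : ι} (hi : i ∉ S) (x : Bits ι) :
    walsh S (flipAt i x) = walsh S x := by
  refine prod_congr rfl fun j hj => ?_
  have : j ≠ i := fun h => hi (h ▸ hj)
  simp [flipAt, Function.update_of_ne this]

theorem walsh_mul_self (S : Finset ι) (x : Bits ι) : walsh S x * walsh S x = 1 := by
  rw [walsh, ← prod_mul_distrib]
  exact prod_eq_one fun i _ => bitVal_mul_self _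

/-- A function that changes sign when coordinate `i` is flipped has mean zero. -/
theorem expect_eq_zero_of_flipAt (i : ι) (F : Bits ι → ℝ) (hF : ∀ x, F (flipAt i x) = -F x) :
    𝔼 x, F x = 0 := by
  have h : 𝔼 x, F x = 𝔼 x, F (flipAt i x) :=
    Fintype.expect_equiv (flipAt_involutive i).toPerm _ _ fun x => by
      simp [flipAt_involutive i x]
  simp only [hF, expect_neg_distrib] at h
  linarith

theorem expect_walsh_mul_walsh (S T : Finset ι) :
    𝔼 x, walsh S x * walsh T x = if S = T then 1 else 0 := by
  split_ifs with h
  · subst h; simp [walsh_mul_self]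
  · have : ∃ i, (i ∈ S ∧ i ∉ T) ∨ (i ∉ S ∧ i ∈ T) := by
      by_contra! hc
      exact h (Finset.ext fun i => ⟨fun hi => by_contra fun h' => (h' ((hc i).1 hi)),
        fun hi => by_contra fun h' => (hc i).2 h' hi⟩)
    obtain ⟨i, hi | hi⟩ := this
    · exact expect_eq_zero_of_flipAt i _ fun x => by
        rw [walsh_flipAt_of_mem hi.1, walsh_flipAt_of_notMem hi.2, neg_mul]
    · exact expect_eq_zero_of_flipAt i _ fun x => by
        rw [walsh_flipAt_of_mem hi.2, walsh_flipAt_of_notMem hi.1, mul_neg]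

theorem sum_walsh_mul_walsh (x y : Bits ι) :
    ∑ S : Finset ι, walsh S x * walsh S y = if x = y then (Fintype.card (Bits ι) : ℝ) else 0 := by
  -- The kernel factors over coordinates, and a coordinate where `x` and `y` differ contributes `1 -
  -- 1 = 0`.
  have h : ∑ S : Finset ι, walsh S x * walsh S y = ∏ i, (1 + bitVal (x i) * bitVal (y i)) := by
    rw [prod_one_add, powerset_univ]
    exact sum_congr rfl fun S _ => by rw [walsh, walsh, prod_mul_distrib]
  rw [h]
  split_ifs with hxy
  · subst hxy
    simp [bitVal_mul_self]
    norm_num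
  · obtain ⟨i, hi⟩ := Function.ne_iff.1 hxy
    refine prod_eq_zero (mem_univ i) ?_
    have : x i = -y i := by
      rcases Int.units_eq_one_or (x i) with h1 | h1 <;>
        rcases Int.units_eq_one_or (y i) with h2 | h2 <;> simp_all
    rw [this, bitVal_neg, neg_mul, bitVal_mul_self, add_neg_cancel]

theorem sum_walshCoeff_mul_walsh (f : Bits ι → ℝ) (x : Bits ι) :
    ∑ S : Finset ι, walshCoeff f S * walsh S x = f x := by
  simp only [walshCoeff, expect_mul]
  rw [← expect_sum_comm]
  have : ∀ y : Bits ι, ∑ S : Finset ι, f y * walsh S y * walsh S x =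
      f y * if y = x then (Fintype.card (Bits ι) : ℝ) else 0 := fun y => by
    rw [← sum_walsh_mul_walsh, mul_sum]
    exact sum_congr rfl fun S _ => by ring
  simp only [this, Fintype.expect_eq_sum_div_card, mul_ite, mul_zero, sum_ite_eq', mem_univ,
    if_true]
  have : (Fintype.card (Bits ι) : ℝ) ≠ 0 := by simp
  field_simp

/-- The `d`-th Fourier weight of a function on the cube. -/
noncomputable def levelWeight (f : Bits ι → ℝ) (d : ℕ) : ℝ :=
  ∑ S ∈ powersetCard d univ, walshCoeff f S ^ 2

/-- A set-valued function `J` of the input is self-determined if it can be read off from the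
coordinates it selects. -/
def SelfDetermined {κ : Type*} (J : Bits κ → Set κ) : Prop :=
  ∀ x y, (∀ i ∈ J x, x i = y i) → J y = J x

theorem SelfDetermined.flipAt_eq {J : Bits ι → Set ι} (hJ : SelfDetermined J) {i : ι} {x : Bits ι}
    (hi : i ∉ J x) : J (flipAt i x) = J x :=
  hJ x _ fun j hj => by
    have : j ≠ i := fun h => hi (h ▸ hj)
    simp [flipAt, Function.update_of_ne this]

/-- A coordinate that is not queried cannot influence what is queried, so flipping it cannot make it
queried. Since flipping is an involution, the converse follows. -/
theorem SelfDetermined.mem_flipAt {J : Bits ι → Set ι} (hJ : SelfDetermined J) (i : ι)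
    (x : Bits ι) : i ∈ J (flipAt i x) ↔ i ∈ J x := by
  by_cases h : i ∈ J x
  · refine ⟨fun _ => h, fun _ => ?_⟩
    by_contra h'
    have := hJ.flipAt_eq h'
    rw [flipAt_involutive i x] at this
    exact h' (this ▸ h)
  · rw [hJ.flipAt_eq h]

-- Flipping an unread coordinate preserves the queried set and reverses the sign of `F`, so
-- contributions cancel in pairs. This is the only source of orthogonality in the Schramm–Steif
-- argument.
open Classical in
theorem SelfDetermined.expect_avoid {J : Bits ι → Set ι} (hJ : SelfDetermined J) (i : ι)
    (p : Set ι → Prop) (hp : ∀ s, p s → i ∉ s) (F : Bits ι → ℝ)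
    (hF : ∀ x, i ∉ J x → F (flipAt i x) = -F x) :
    𝔼 x, (if p (J x) then F x else 0) = 0 := by
  refine expect_eq_zero_of_flipAt i _ fun x => ?_
  by_cases hi : i ∈ J x
  · have h1 : ¬ p (J x) := fun h => hp _ h hi
    have h2 : ¬ p (J (flipAt i x)) := fun h => hp _ h ((hJ.mem_flipAt i x).2 hi)
    simp [h1, h2]
  · rw [hJ.flipAt_eq hi, hF x hi]
    split_ifs <;> simp

open Classical in
/-- One deterministic query rule: the square of the `d`-th weight is controlled by the coefficients
whose support is hit by the queried set. -/
theorem levelWeight_sq_le {J : Bits ι → Set ι} (hJ : SelfDetermined J) (f : Bits ι → ℝ)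
    (hf1 : ∀ x, |f x| = 1) (hf : ∀ x y, (∀ i ∈ J x, x i = y i) → f x = f y) {d : ℕ} (hd : 1 ≤ d) :
    levelWeight f d ^ 2 ≤ ∑ S ∈ powersetCard d univ,
      walshCoeff f S ^ 2 * 𝔼 x, (if Disjoint (S : Set ι) (J x) then 0 else 1 : ℝ) := by
  set P := powersetCard d (univ : Finset ι)
  set a := walshCoeff f
  set v : Finset ι → Bits ι → ℝ := fun S x => if Disjoint (S : Set ι) (J x) then 1 else 0
  -- `g` is the level-`d` part of `f`, and `q` keeps those of its terms whose support is entirely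
  -- unread. As `f` is blind to `q`, the weight is the inner product of `f` with `g - q`, to which
  -- Cauchy–Schwarz applies.
  set g : Bits ι → ℝ := fun x => ∑ S ∈ P, a S * walsh S x
  set q : Bits ι → ℝ := fun x => ∑ S ∈ P, a S * (walsh S x * v S x)
  have hfg : 𝔼 x, f x * g x = levelWeight f d := by
    simp only [g, mul_sum]
    rw [expect_sum_comm]
    refine sum_congr rfl fun S _ => ?_
    rw [sq]; nth_rewrite 2 [walshCoeff]; rw [mul_expect]
    exact expect_congr rfl fun x _ => by ring
  have hfq : 𝔼 x, f x * q x = 0 := by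
    simp only [q, mul_sum]
    rw [expect_sum_comm]
    refine sum_eq_zero fun S hS => ?_
    have hne : S.Nonempty := by
      rw [← card_pos, (mem_powersetCard.1 hS).2]; omega
    obtain ⟨i, hi⟩ := hne
    have := hJ.expect_avoid i (fun s => Disjoint (S : Set ι) s)
      (fun s hs h => Set.disjoint_left.1 hs (mem_coe.2 hi) h) (fun x => f x * (a S * walsh S x))
      (fun x hx => by
        rw [walsh_flipAt_of_mem hi, ← hf x (flipAt i x)]
        · ring
        · intro j hj
          have : j ≠ i := fun h => hx (h ▸ hj)
          simp [flipAt, Function.update_of_ne this])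
    rw [← this]
    refine expect_congr rfl fun x _ => ?_
    simp only [v]; split_ifs <;> ring
  -- Distinct sets of equal size give a coordinate of `T` outside `S`. On the event that `T` is
  -- unread, flipping it changes the sign.
  have hcross : ∀ S ∈ P, ∀ T ∈ P, S ≠ T → ∀ r : Finset ι → Set ι → ℝ,
      𝔼 x, walsh S x * walsh T x * (r S (J x) * v T x) = 0 := by
    intro S hS T hT hST r
    have : ∃ i, i ∈ T ∧ i ∉ S := by
      by_contra! hc
      exact hST (eq_of_subset_of_card_le hc (by
        rw [(mem_powersetCard.1 hS).2, (mem_powersetCard.1 hT).2])).symm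
    obtain ⟨i, hi, hi'⟩ := this
    have := hJ.expect_avoid i (fun s => Disjoint (T : Set ι) s)
      (fun s hs h => Set.disjoint_left.1 hs (mem_coe.2 hi) h)
      (fun x => walsh S x * walsh T x * r S (J x))
      (fun x hx => by
        rw [walsh_flipAt_of_mem hi, walsh_flipAt_of_notMem hi', hJ.flipAt_eq hx]; ring)
    rw [← this]
    refine expect_congr rfl fun x _ => ?_
    simp only [v]; split_ifs <;> ring
  have hvv : ∀ S x, v S x * v S x = v S x := fun S x => by simp only [v]; split_ifs <;> simp
  -- The factor `r` treats `g` (`r = 1`) and `q` (`r` the disjointness indicator) at once. Both have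
  -- the same inner product with `q`, so `g - q` is orthogonal to `q`.
  have hdiag : ∀ r : Finset ι → Set ι → ℝ, (∀ S x, r S (J x) * v S x = v S x) →
      𝔼 x, (∑ S ∈ P, a S * (walsh S x * r S (J x))) * q x = ∑ S ∈ P, a S ^ 2 * 𝔼 x, v S x := by
    intro r hr
    simp only [q, sum_mul_sum]
    rw [expect_sum_comm]
    refine sum_congr rfl fun S hS => ?_
    rw [expect_sum_comm, sum_eq_single S]
    · rw [mul_expect]
      refine expect_congr rfl fun x _ => ?_
      calc _ = a S ^ 2 * (walsh S x * walsh S x) * (r S (J x) * v S x) := by ring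
        _ = _ := by rw [walsh_mul_self, hr, mul_one]
    · intro T hT hTS
      have := hcross S hS T hT hTS.symm r
      calc _ = 𝔼 x, (a S * a T) * (walsh S x * walsh T x * (r S (J x) * v T x)) :=
            expect_congr rfl fun x _ => by ring
        _ = 0 := by rw [← mul_expect, this, mul_zero]
    · exact fun h => absurd hS h
  have hgq : 𝔼 x, g x * q x = ∑ S ∈ P, a S ^ 2 * 𝔼 x, v S x := by
    have := hdiag (fun _ _ => 1) (fun _ _ => one_mul _)
    simpa only [mul_one] using this
  have hqq : 𝔼 x, q x * q x = ∑ S ∈ P, a S ^ 2 * 𝔼 x, v S x :=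
    hdiag (fun S s => if Disjoint (S : Set ι) s then 1 else 0) hvv
  have hgg : 𝔼 x, g x * g x = ∑ S ∈ P, a S ^ 2 := by
    simp only [g, sum_mul_sum]
    rw [expect_sum_comm]
    refine sum_congr rfl fun S hS => ?_
    rw [expect_sum_comm, sum_eq_single S]
    · calc _ = 𝔼 x : Bits ι, a S ^ 2 := expect_congr rfl fun x _ => by
            rw [← mul_one (a S ^ 2), ← walsh_mul_self S x]; ring
        _ = _ := by simp
    · intro T hT hTS
      calc _ = 𝔼 x, (a S * a T) * (walsh S x * walsh T x) :=
            expect_congr rfl fun x _ => by ring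
        _ = 0 := by rw [← mul_expect, expect_walsh_mul_walsh, if_neg hTS.symm, mul_zero]
    · exact fun h => absurd hS h
  have hnorm : 𝔼 x, (g x - q x) ^ 2 = ∑ S ∈ P, a S ^ 2 *
      𝔼 x, (if Disjoint (S : Set ι) (J x) then 0 else 1 : ℝ) := by
    have h1 : 𝔼 x, (g x - q x) ^ 2 =
        𝔼 x, g x * g x - 2 * 𝔼 x, g x * q x + 𝔼 x, q x * q x := by
      rw [mul_expect, ← expect_sub_distrib, ← expect_add_distrib]
      exact expect_congr rfl fun x _ => by ring
    have h2 : ∀ S : Finset ι, 𝔼 x, (if Disjoint (S : Set ι) (J x) then 0 else 1 : ℝ) = 1 - 𝔼 x, v S x := by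
      intro S
      have : (1 : ℝ) = 𝔼 x : Bits ι, (1 : ℝ) := by simp
      rw [this, ← expect_sub_distrib]
      exact expect_congr rfl fun x _ => by simp only [v]; split_ifs <;> simp
    simp only [h1, hgg, hgq, hqq, h2, mul_sub, mul_one, sum_sub_distrib]
    ring
  have hCS : (𝔼 x, f x * (g x - q x)) ^ 2 ≤ (𝔼 x, f x ^ 2) * 𝔼 x, (g x - q x) ^ 2 := by
    simp only [Fintype.expect_eq_sum_div_card]
    rw [div_mul_div_comm, div_pow, ← sq]
    gcongr
    exact sum_mul_sq_le_sq_mul_sq _ _ _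
  have hf2 : 𝔼 x, f x ^ 2 = 1 := by
    simp [← sq_abs (f _), hf1]
  rw [hf2, one_mul, hnorm] at hCS
  refine le_trans (le_of_eq ?_) hCS
  congr 1
  rw [← hfg]
  simp only [mul_sub]
  rw [expect_sub_distrib, hfq, sub_zero]

open Classical in
/-- **Schramm–Steif inequality.** If a `±1`-valued function is determined by a random
self-determined set of coordinates, each of which is selected with probability at most `δ`, then its
Fourier weight at level `d` is at most `d * δ`. -/
theorem levelWeight_le {R : Type*} [Fintype R] [Nonempty R] (J : R → Bits ι → Set ι)
    (hJ : ∀ r, SelfDetermined (J r)) (f : Bits ι → ℝ) (hf1 : ∀ x, |f x| = 1)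
    (hf : ∀ r x y, (∀ i ∈ J r x, x i = y i) → f x = f y) {δ : ℝ} (hδ0 : 0 ≤ δ)
    (hδ : ∀ i, 𝔼 r, 𝔼 x, (if i ∈ J r x then 1 else 0 : ℝ) ≤ δ) {d : ℕ} (hd : 1 ≤ d) :
    levelWeight f d ≤ d * δ := by
  set W := levelWeight f d
  have hW : 0 ≤ W := sum_nonneg fun S _ => sq_nonneg _
  have h1 : W ^ 2 ≤ 𝔼 r, ∑ S ∈ powersetCard d univ,
      walshCoeff f S ^ 2 * 𝔼 x, (if Disjoint (S : Set ι) (J r x) then 0 else 1 : ℝ) :=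
    le_expect univ_nonempty fun r _ => levelWeight_sq_le (hJ r) f hf1 (hf r) hd
  rw [expect_sum_comm] at h1
  have h2 : ∀ S ∈ powersetCard d (univ : Finset ι),
      𝔼 r, walshCoeff f S ^ 2 * 𝔼 x, (if Disjoint (S : Set ι) (J r x) then 0 else 1 : ℝ) ≤
        walshCoeff f S ^ 2 * (d * δ) := by
    intro S hS
    rw [← mul_expect]
    refine mul_le_mul_of_nonneg_left ?_ (sq_nonneg _)
    calc 𝔼 r, 𝔼 x, (if Disjoint (S : Set ι) (J r x) then 0 else 1 : ℝ)
        ≤ 𝔼 r, 𝔼 x, ∑ i ∈ S, (if i ∈ J r x then 1 else 0 : ℝ) := by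
          refine expect_le_expect fun r _ => expect_le_expect fun x _ => ?_
          split_ifs with h
          · exact sum_nonneg fun i _ => by split_ifs <;> norm_num
          · obtain ⟨i, hi, hi'⟩ := Set.not_disjoint_iff.1 h
            refine le_trans (by simp [hi']) (single_le_sum
              (f := fun i => (if i ∈ J r x then 1 else 0 : ℝ)) (fun i _ => ?_) hi)
            split_ifs <;> norm_num
      _ = ∑ i ∈ S, 𝔼 r, 𝔼 x, (if i ∈ J r x then 1 else 0 : ℝ) := by
          rw [← expect_sum_comm]
          exact expect_congr rfl fun r _ => by rw [expect_sum_comm]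
      _ ≤ ∑ _i ∈ S, δ := sum_le_sum fun i _ => hδ i
      _ = d * δ := by rw [sum_const, (mem_powersetCard.1 hS).2, nsmul_eq_mul]
  have h3 : W ^ 2 ≤ W * (d * δ) := h1.trans ((sum_le_sum h2).trans (by rw [← sum_mul]; rfl))
  rcases hW.eq_or_lt with h0 | h0
  · rw [← h0]
    positivity
  · nlinarith

end Fourier

/-! ### The noise operator and the covariance in terms of Fourier weights. -/

section Noise

open Finset
open scoped BigOperators

variable {ι : Type*} [Fintype ι] [DecidableEq ι]

instance : MeasurableSingletonClass ℤˣ where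
  measurableSet_singleton a :=
    ⟨{(a : ℤ)}, measurableSet_singleton _, by ext b; simp [Units.ext_iff]⟩

theorem isProbabilityMeasure_coin {ε : ℝ} (h0 : 0 ≤ ε) (h1 : ε ≤ 1) :
    IsProbabilityMeasure (coin ε) := by
  refine ⟨?_⟩
  simp only [coin, Measure.coe_add, Measure.coe_smul, Pi.add_apply, Pi.smul_apply, measure_univ,
    smul_eq_mul, mul_one]
  rw [← ENNReal.ofReal_add (by linarith) h0]
  simp

theorem integral_coin {ε : ℝ} (h0 : 0 ≤ ε) (h1 : ε ≤ 1) (F : ℤˣ → ℝ) :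
    ∫ z, F z ∂(coin ε) = (1 - ε) * F 1 + ε * F (-1) := by
  rw [coin, integral_add_measure, integral_smul_measure, integral_smul_measure, integral_dirac,
    integral_dirac, ENNReal.toReal_ofReal (by linarith), ENNReal.toReal_ofReal h0, smul_eq_mul,
    smul_eq_mul]
  · exact (integrable_dirac (by simp)).smul_measure ENNReal.ofReal_ne_top
  · exact (integrable_dirac (by simp)).smul_measure ENNReal.ofReal_ne_top

instance : IsProbabilityMeasure (coin (1 / 2)) :=
  isProbabilityMeasure_coin (by norm_num) (by norm_num)

instance : IsProbabilityMeasure (uniformBits ι) := by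
  unfold uniformBits; infer_instance

theorem isProbabilityMeasure_noisyPair {ε : ℝ} (h0 : 0 ≤ ε) (h1 : ε ≤ 1) :
    IsProbabilityMeasure (noisyPair ι ε) := by
  have := isProbabilityMeasure_coin h0 h1
  exact Measure.isProbabilityMeasure_map (Measurable.of_discrete).aemeasurable

theorem integral_uniformBits (F : Bits ι → ℝ) : ∫ x, F x ∂(uniformBits ι) = 𝔼 x, F x := by
  have h : ∀ x : Bits ι, (uniformBits ι).real {x} = (Fintype.card (Bits ι) : ℝ)⁻¹ := by
    intro x
    have hc : ∀ a : ℤˣ, coin (1 / 2) {a} = ENNReal.ofReal (1 / 2) := by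
      intro a
      rcases Int.units_eq_one_or a with rfl | rfl <;> simp only [coin, Measure.coe_add,
        Measure.coe_smul, Pi.add_apply, Pi.smul_apply, measurableSet_singleton,
        Measure.dirac_apply', smul_eq_mul] <;> norm_num [Set.indicator]
    rw [Measure.real, uniformBits, Measure.pi_singleton]
    simp only [hc]
    simp
  rw [integral_fintype (Integrable.of_finite)]
  simp only [h, Fintype.expect_eq_sum_div_card, smul_eq_mul, ← mul_sum]
  ring

theorem integral_walsh_coin {ε : ℝ} (h0 : 0 ≤ ε) (h1 : ε ≤ 1) (T : Finset ι) :
    ∫ z, walsh T z ∂(Measure.pi fun _ : ι => coin ε) = (1 - 2 * ε) ^ T.card := by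
  have := isProbabilityMeasure_coin h0 h1
  have h : ∀ z : Bits ι, walsh T z = ∏ i, (if i ∈ T then bitVal (z i) else 1) := by
    intro z; rw [walsh, prod_ite_mem, univ_inter]
  simp only [h]
  rw [integral_fintype_prod_eq_prod (𝕜 := ℝ) (fun i (a : ℤˣ) => if i ∈ T then bitVal a else 1)]
  have : ∀ i, ∫ a, (if i ∈ T then bitVal a else 1) ∂(coin ε) =
      if i ∈ T then (1 - 2 * ε) else 1 := by
    intro i
    split_ifs
    · rw [integral_coin h0 h1, bitVal_neg, bitVal_one]; ring
    · simp
  simp only [this]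
  rw [prod_ite_mem, univ_inter, prod_const]

theorem walsh_mul (T : Finset ι) (x z : Bits ι) :
    walsh T (fun i => x i * z i) = walsh T x * walsh T z := by
  simp only [walsh, bitVal_mul, prod_mul_distrib]

theorem integral_noisyPair {ε : ℝ} (h0 : 0 ≤ ε) (h1 : ε ≤ 1) (F : Bits ι → Bits ι → ℝ) :
    ∫ q, F q.1 q.2 ∂(noisyPair ι ε) =
      𝔼 x, ∫ z, F x (fun i => x i * z i) ∂(Measure.pi fun _ : ι => coin ε) := by
  have := isProbabilityMeasure_coin h0 h1
  rw [noisyPair, integral_map (Measurable.of_discrete).aemeasurable Measurable.of_discrete.aestronglyMeasurable, integral_prod _ Integrable.of_finite,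
    integral_uniformBits]

/-- Noise is diagonal in the Walsh basis: characters are multiplicative, and each noise bit has mean
`1 - 2ε`. -/
theorem integral_noisy {ε : ℝ} (h0 : 0 ≤ ε) (h1 : ε ≤ 1) (f : Bits ι → ℝ) (x : Bits ι) :
    ∫ z, f (fun i => x i * z i) ∂(Measure.pi fun _ : ι => coin ε) =
      ∑ S, (1 - 2 * ε) ^ S.card * (walshCoeff f S * walsh S x) := by
  have := isProbabilityMeasure_coin h0 h1
  simp only [← sum_walshCoeff_mul_walsh f (fun i => x i * _), walsh_mul]
  rw [integral_finsetSum _ fun _ _ => Integrable.of_finite]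
  refine sum_congr rfl fun S _ => ?_
  rw [integral_const_mul, integral_const_mul, integral_walsh_coin h0 h1]
  ring

theorem integral_noisyPair_mul {ε : ℝ} (h0 : 0 ≤ ε) (h1 : ε ≤ 1) (f g : Bits ι → ℝ) :
    ∫ q, g q.1 * f q.2 ∂(noisyPair ι ε) =
      ∑ S, (1 - 2 * ε) ^ S.card * (walshCoeff g S * walshCoeff f S) := by
  rw [integral_noisyPair h0 h1 fun x y => g x * f y]
  simp only [integral_const_mul, integral_noisy h0 h1, mul_sum]
  rw [expect_sum_comm]
  refine sum_congr rfl fun S _ => ?_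
  nth_rewrite 2 [walshCoeff]
  rw [expect_mul, mul_expect]
  exact expect_congr rfl fun x _ => by ring

theorem walshCoeff_one (S : Finset ι) : walshCoeff (fun _ => 1) S = if S = ∅ then 1 else 0 := by
  have := expect_walsh_mul_walsh (ι := ι) ∅ S
  simp only [walsh, prod_empty] at this
  rw [walshCoeff]
  simp only [walsh, this, eq_comm]

theorem noiseCov_eq {ε : ℝ} (h0 : 0 ≤ ε) (h1 : ε ≤ 1) (f : BoolFun ι) :
    noiseCov f ε = ∑ S ∈ univ.erase ∅,
      (1 - 2 * ε) ^ S.card * walshCoeff (fun x => bitVal (f x)) S ^ 2 := by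
  have := isProbabilityMeasure_noisyPair (ι := ι) h0 h1
  set F : Bits ι → ℝ := fun x => bitVal (f x)
  rw [noiseCov, covariance_eq_sub]
  · have e1 := integral_noisyPair_mul h0 h1 F F
    have e2 := integral_noisyPair_mul h0 h1 (fun _ => 1) F
    have e3 := integral_noisyPair_mul h0 h1 F (fun _ => 1)
    simp only [walshCoeff_one, mul_one, one_mul, mul_ite, ite_mul, mul_zero, zero_mul, sum_ite_eq',
      mem_univ, if_true, card_empty, pow_zero] at e2 e3
    change ∫ q, F q.1 * F q.2 ∂(noisyPair ι ε) -
      (∫ q, F q.1 ∂(noisyPair ι ε)) * ∫ q, F q.2 ∂(noisyPair ι ε) = _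
    rw [e1, e2, e3, ← add_sum_erase _ _ (mem_univ ∅)]
    simp [sq]
  · exact MemLp.of_bound Measurable.of_discrete.aestronglyMeasurable 1 (ae_of_all _ fun q => by
      simp [abs_bitVal])
  · exact MemLp.of_bound Measurable.of_discrete.aestronglyMeasurable 1 (ae_of_all _ fun q => by
      simp [abs_bitVal])

theorem noiseCov_nonneg {ε : ℝ} (h0 : 0 ≤ ε) (h1 : ε ≤ 1 / 2) (f : BoolFun ι) :
    0 ≤ noiseCov f ε := by
  rw [noiseCov_eq h0 (by linarith)]
  exact sum_nonneg fun S _ => mul_nonneg (pow_nonneg (by linarith) _) (sq_nonneg _)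

/-- A linear bound on all Fourier weights bounds the noise covariance. -/
theorem noiseCov_le {ε : ℝ} (h0 : 0 < ε) (h1 : ε ≤ 1 / 2) (f : BoolFun ι) {δ : ℝ} (hδ : 0 ≤ δ)
    (hf : ∀ d, 1 ≤ d → levelWeight (fun x => bitVal (f x)) d ≤ d * δ) :
    noiseCov f ε ≤ δ / ε ^ 2 := by
  set ρ := 1 - 2 * ε with hρ
  have hρ0 : 0 ≤ ρ := by linarith
  have hρ1 : ρ < 1 := by linarith
  rw [noiseCov_eq h0.le (by linarith)]
  have e1 : ∑ S ∈ univ.erase ∅, ρ ^ S.card * walshCoeff (fun x => bitVal (f x)) S ^ 2 =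
      ∑ d ∈ Icc 1 (Fintype.card ι), ρ ^ d * levelWeight (fun x => bitVal (f x)) d := by
    rw [← sum_fiberwise_of_maps_to (s := univ.erase (∅ : Finset ι)) (t := Icc 1 (Fintype.card ι))
      (g := Finset.card)]
    · refine sum_congr rfl fun d hd => ?_
      rw [levelWeight, mul_sum]
      have : {S ∈ univ.erase (∅ : Finset ι) | S.card = d} = powersetCard d univ := by
        ext S
        simp only [mem_filter, mem_erase, mem_univ, and_true, mem_powersetCard, subset_univ,
          true_and, and_iff_right_iff_imp]
        rintro rfl rfl
        simp at hd
      rw [this]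
      exact sum_congr rfl fun S hS => by rw [(mem_powersetCard.1 hS).2]
    · intro S hS
      rw [mem_Icc]
      exact ⟨card_pos.2 (nonempty_iff_ne_empty.2 (ne_of_mem_erase hS)), card_le_univ S⟩
  rw [e1]
  have hn : ‖ρ‖ < 1 := by rwa [Real.norm_of_nonneg hρ0]
  have e2 : HasSum (fun d : ℕ => (d : ℝ) * ρ ^ d) (ρ / (1 - ρ) ^ 2) :=
    hasSum_coe_mul_geometric_of_norm_lt_one hn
  calc _ ≤ ∑ d ∈ Icc 1 (Fintype.card ι), ((d : ℝ) * ρ ^ d) * δ := by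
        refine sum_le_sum fun d hd => ?_
        have := mul_le_mul_of_nonneg_left (hf d (mem_Icc.1 hd).1) (pow_nonneg hρ0 d)
        linarith
    _ = (∑ d ∈ Icc 1 (Fintype.card ι), (d : ℝ) * ρ ^ d) * δ := by rw [sum_mul]
    _ ≤ (ρ / (1 - ρ) ^ 2) * δ := by
        gcongr
        exact sum_le_hasSum _ (fun d _ => by positivity) e2
    _ ≤ δ / ε ^ 2 := by
        rw [div_mul_eq_mul_div, div_le_div_iff₀ (by nlinarith) (by positivity)]
        have : (1 - ρ) ^ 2 = 4 * ε ^ 2 := by rw [hρ]; ring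
        rw [this]
        have : ρ * δ ≤ δ := by nlinarith
        nlinarith [sq_nonneg ε, mul_nonneg hδ (sq_nonneg ε)]

end Noise

section Rows

/-! ### Rows as infinite sequences -/

/-- A Boolean gate with three inputs. -/
abbrev Gate : Type := ℤˣ → ℤˣ → ℤˣ → ℤˣ

/-- A gate is odd if it commutes with a global change of sign. -/
def Gate.IsOdd (g : Gate) : Prop := ∀ s a b c, g (s * a) (s * b) (s * c) = s * g a b c

/-- A gate is regular if any two equal inputs decide its value; regular odd gates are the
3-majority and its negative. -/
def Gate.IsRegular (g : Gate) : Prop :=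
  ∀ a x, g a a x = g a a a ∧ g a x a = g a a a ∧ g x a a = g a a a

/-- The stride-2 convolution of a sequence with a gate. -/
def convRow (g : Gate) (x : Bits ℕ) : Bits ℕ :=
  fun i => g (x (2 * i)) (x (2 * i + 1)) (x (2 * i + 2))

/-- The `k`-th row of the network with gates `g 0, g 1, …` and bottom row `x`. -/
def rows (g : ℕ → Gate) : ℕ → Bits ℕ → Bits ℕ
  | 0, x => x
  | k + 1, x => convRow (g k) (rows g k x)

/-- Fixes the input cone of a node: node `i` of row `k` sees the inputs from `2^k * i` to `2^k * (i
+ 2) - 2`. Oddness carries a common sign on this cone up to the node. -/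
theorem rows_mul {g : ℕ → Gate} (hg : ∀ k, (g k).IsOdd) (s : ℤˣ) {x x' : Bits ℕ} (k i : ℕ)
    (h : ∀ j, 2 ^ k * i ≤ j → j + 1 < 2 ^ k * (i + 2) → x' j = s * x j) :
    rows g k x' i = s * rows g k x i := by
  induction k generalizing i with
  | zero => exact h i (by simp) (by simp)
  | succ k ih =>
    have key : ∀ e ≤ 2, rows g k x' (2 * i + e) = s * rows g k x (2 * i + e) := fun e he =>
      ih _ fun j h1 h2 => h j
        (le_trans (by rw [pow_succ, mul_assoc]; exact Nat.mul_le_mul_left _ (by omega)) h1)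
        (h2.trans_le (by rw [pow_succ, mul_assoc]; exact Nat.mul_le_mul_left _ (by omega)))
    have e0 := key 0 (by norm_num)
    rw [add_zero] at e0
    simp only [rows, convRow, e0, key 1 (by norm_num), key 2 le_rfl, hg k s _ _ _]

theorem rows_congr {g : ℕ → Gate} (hg : ∀ k, (g k).IsOdd) {x x' : Bits ℕ} (k i : ℕ)
    (h : ∀ j, 2 ^ k * i ≤ j → j + 1 < 2 ^ k * (i + 2) → x' j = x j) :
    rows g k x' i = rows g k x i := by
  rw [rows_mul hg 1 k i fun j h1 h2 => by rw [h j h1 h2, one_mul], one_mul]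

theorem convRow_of_left {g : Gate} (hg : g.IsRegular) {x : Bits ℕ} {a : ℤˣ} (i : ℕ)
    (h0 : x (2 * i) = a) (h1 : x (2 * i + 1) = a) : convRow g x i = g a a a := by
  rw [convRow, h0, h1, (hg a _).1]

theorem convRow_of_sides {g : Gate} (hg : g.IsRegular) {x : Bits ℕ} {a : ℤˣ} (i : ℕ)
    (h0 : x (2 * i) = a) (h1 : x (2 * i + 2) = a) : convRow g x i = g a a a := by
  rw [convRow, h0, h1, (hg a _).2.1]

theorem convRow_of_right {g : Gate} (hg : g.IsRegular) {x : Bits ℕ} {a : ℤˣ} (i : ℕ)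
    (h0 : x (2 * i + 1) = a) (h1 : x (2 * i + 2) = a) : convRow g x i = g a a a := by
  rw [convRow, h0, h1, (hg a _).2.2]

/-- The value of three layers of gates at a constant triple of constant triples. -/
def tripleValue (g : ℕ → Gate) (τ : ℤˣ) : ℤˣ :=
  let a := g 0 τ τ τ
  let b := g 1 a a a
  g 2 b b b

theorem tripleValue_mul {g : ℕ → Gate} (hg : ∀ k, (g k).IsOdd) (s τ : ℤˣ) :
    tripleValue g (s * τ) = s * tripleValue g τ := by
  simp only [tripleValue, hg 0 s _ _ _, hg 1 s _ _ _, hg 2 s _ _ _]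

/-- If all even nodes but one below a node three layers up agree, then they decide its value. -/
theorem rows_three_eq {g : ℕ → Gate} (hreg : ∀ k < 4, (g k).IsRegular) {y : Bits ℕ} {τ : ℤˣ}
    (J o : ℕ) (h : ∀ i < 8, i ≠ o → y (16 * J + 2 * i) = τ) :
    rows g 3 y (2 * J) = tripleValue g τ := by
  have h1 : ∀ i < 7, i ≠ o → i + 1 ≠ o → rows g 1 y (8 * J + i) = g 0 τ τ τ := by
    intro i hi h0 h0'
    refine convRow_of_sides (hreg 0 (by norm_num)) _ ?_ ?_
    · rw [← h i (by omega) h0]; exact congrArg y (by ring)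
    · rw [← h (i + 1) (by omega) h0']; exact congrArg y (by ring)
  set a := g 0 τ τ τ with ha
  -- The two exclusions keep the middle child intact. The defect then spoils at most one outer
  -- child, and the other two decide the gate.
  have h2 : ∀ j < 3, 2 * j + 1 ≠ o → 2 * j + 2 ≠ o → rows g 2 y (4 * J + j) = g 1 a a a := by
    intro j hj h0 h0'
    rcases lt_or_ge (2 * j) o with h3 | h3
    · refine convRow_of_left (hreg 1 (by norm_num)) _ ?_ ?_
      · rw [← h1 (2 * j) (by omega) (by omega) (by omega)]; exact congrArg _ (by ring)
      · rw [← h1 (2 * j + 1) (by omega) (by omega) (by omega)]; exact congrArg _ (by ring)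
    · refine convRow_of_right (hreg 1 (by norm_num)) _ ?_ ?_
      · rw [← h1 (2 * j + 1) (by omega) (by omega) (by omega)]; exact congrArg _ (by ring)
      · rw [← h1 (2 * j + 2) (by omega) (by omega) (by omega)]; exact congrArg _ (by ring)
  set b := g 1 a a a with hb
  have e0 : 2 * (2 * J) = 4 * J + 0 := by ring
  have e1 : 2 * (2 * J) + 1 = 4 * J + 1 := by ring
  have e2 : 2 * (2 * J) + 2 = 4 * J + 2 := by ring
  change convRow (g 2) (rows g 2 y) (2 * J) = g 2 b b b
  have r2 := hreg 2 (by norm_num)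
  -- At most one of the three children is spoiled: the first if `o` is 1 or 2, the second if it is 3
  -- or 4, the third if it is 5 or 6.
  rcases Nat.lt_or_ge o 3 with h3 | h3
  · refine convRow_of_right r2 _ ?_ ?_
    · rw [e1, h2 1 (by omega) (by omega) (by omega)]
    · rw [e2, h2 2 (by omega) (by omega) (by omega)]
  rcases Nat.lt_or_ge o 5 with h4 | h4
  · refine convRow_of_sides r2 _ ?_ ?_
    · rw [e0, h2 0 (by omega) (by omega) (by omega)]
    · rw [e2, h2 2 (by omega) (by omega) (by omega)]
  · refine convRow_of_left r2 _ ?_ ?_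
    · rw [e0, h2 0 (by omega) (by omega) (by omega)]
    · rw [e1, h2 1 (by omega) (by omega) (by omega)]

/-- The neighbour in row 3 (to the left or to the right of block `J`) to which the block has to be
aligned in order to hide the subblock `t`. -/
def AlignedAt (g : ℕ → Gate) (y : Bits ℕ) (J t : ℕ) (τ : ℤˣ) : Prop :=
  (t < 16 * J + 8 ∧ ∀ J', J' + 1 = J → rows g 3 y (2 * J') = tripleValue g τ) ∨
    (16 * J + 8 ≤ t ∧ rows g 3 y (2 * J + 2) = tripleValue g τ)

variable {g : ℕ → Gate} (hg : ∀ k, (g k).IsOdd) (hreg : ∀ k < 4, (g k).IsRegular)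
  {y y' : Bits ℕ} {τ : ℤˣ} {J t : ℕ} (ht : 16 * J ≤ t) (ht' : t < 16 * J + 16)
  (hτ : ∀ i < 8, y (16 * J + 2 * i) = τ) (hal : AlignedAt g y J t τ)

include hg hreg ht ht' hτ hal

/-- Node `2 * J` of row 3 survives hiding the nodes next to `t`. If `t` is in the left half, the
other two children of node `J` do not see the hidden nodes. If it is in the right half, only the
middle child may change, and it is outvoted by the two aligned outer children. -/
theorem rows_four_eq_right
    (hyy : ∀ i, 16 * J ≤ i → i ≤ 16 * J + 30 → i ≠ t → i + 1 ≠ t → y' i = y i) :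
    rows g 4 y' J = rows g 4 y J := by
  -- The index 8 is out of range and stands for no exception.
  have hW : rows g 3 y (2 * J) = tripleValue g τ :=
    rows_three_eq hreg J 8 fun i hi _ => hτ i hi
  have hW' : rows g 3 y' (2 * J) = tripleValue g τ :=
    -- Exactly one of the hidden nodes `t - 1` and `t` is even, so only one even node is lost.
    rows_three_eq hreg J ((t - 16 * J) / 2) fun i hi hne => by
      rw [hyy _ (by omega) (by omega) (by omega) (by omega), hτ i hi]
  have hD : rows g 3 y' (2 * J + 2) = rows g 3 y (2 * J + 2) :=
    rows_congr hg 3 _ fun j h1 h2 => hyy j (by omega) (by omega) (by omega) (by omega)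
  have r3 := hreg 3 (by norm_num)
  rcases hal with ⟨h, -⟩ | ⟨h, h'⟩
  · have hV : rows g 3 y' (2 * J + 1) = rows g 3 y (2 * J + 1) :=
      rows_congr hg 3 _ fun j h1 h2 => hyy j (by omega) (by omega) (by omega) (by omega)
    change g 3 _ _ _ = g 3 _ _ _
    rw [hW, hW', hD, hV]
  · rw [show rows g 4 y' J = _ from convRow_of_sides r3 J hW' (hD.trans h'),
      show rows g 4 y J = _ from convRow_of_sides r3 J hW h']

/-- The mirror case: node `J - 1` has `2 * J` as its right child, so the left half of block `J` now
needs the vote and the right half is out of sight of its other children. -/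
theorem rows_four_eq_left {J' : ℕ} (hJ : J' + 1 = J)
    (hyy : ∀ i, 16 * J' ≤ i → i ≤ 16 * J' + 30 → i ≠ t → i + 1 ≠ t → y' i = y i) :
    rows g 4 y' J' = rows g 4 y J' := by
  have e : 2 * J' + 2 = 2 * J := by omega
  have hW : rows g 3 y (2 * J' + 2) = tripleValue g τ := by
    rw [e]; exact rows_three_eq hreg J 8 fun i hi _ => hτ i hi
  have hW' : rows g 3 y' (2 * J' + 2) = tripleValue g τ := by
    rw [e]
    exact rows_three_eq hreg J ((t - 16 * J) / 2) fun i hi hne => by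
      rw [hyy _ (by omega) (by omega) (by omega) (by omega), hτ i hi]
  have hD : rows g 3 y' (2 * J') = rows g 3 y (2 * J') :=
    rows_congr hg 3 _ fun j h1 h2 => hyy j (by omega) (by omega) (by omega) (by omega)
  have r3 := hreg 3 (by norm_num)
  rcases hal with ⟨h, h'⟩ | ⟨h, -⟩
  · rw [show rows g 4 y' J' = _ from convRow_of_sides r3 J' (hD.trans (h' J' hJ)) hW',
      show rows g 4 y J' = _ from convRow_of_sides r3 J' (h' J' hJ) hW]
  · have hV : rows g 3 y' (2 * J' + 1) = rows g 3 y (2 * J' + 1) :=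
      rows_congr hg 3 _ fun j h1 h2 => hyy j (by omega) (by omega) (by omega) (by omega)
    change g 3 _ _ _ = g 3 _ _ _
    rw [hW, hW', hD, hV]

end Rows

section Query

open Finset
open scoped BigOperators

/-! ### Query rules -/

/-- `x` and `y` agreeing on `s`. -/
def AgreeOn {κ : Type*} (s : Set κ) (x y : Bits κ) : Prop := ∀ i ∈ s, x i = y i

/-- Block `t` is touched by a set of nodes if the set contains one of the two nodes that depend on
it. -/
def Touches (s : Set ℕ) (t : ℕ) : Prop := ∃ j ∈ s, j = t ∨ j + 1 = t

/-- Extension of a finite bit string by `1`. -/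
def extendBits {N : ℕ} (x : Bits (Fin N)) : Bits ℕ := fun i => if h : i < N then x ⟨i, h⟩ else 1

open Classical in
/-- The indicator of a proposition as a real number. -/
noncomputable def ind (p : Prop) : ℝ := if p then 1 else 0

theorem ind_nonneg (p : Prop) : 0 ≤ ind p := by unfold ind; split_ifs <;> norm_num

theorem ind_le_one (p : Prop) : ind p ≤ 1 := by unfold ind; split_ifs <;> norm_num

theorem ind_mono {p q : Prop} (h : p → q) : ind p ≤ ind q := by
  unfold ind; split_ifs <;> first | exact absurd (h ‹p›) ‹¬ q› | norm_num

theorem ind_of_true {p : Prop} (h : p) : ind p = 1 := if_pos h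

/-- There is a random self-determined rule for querying nodes of row `k` that determines the
function `F` of that row, such that each of the first `M` blocks is touched with probability at most
`δ` when the `N` input bits are uniform. -/
def HasQueryRule (g : ℕ → Gate) (N k : ℕ) (F : Bits ℕ → ℤˣ) (M : ℕ) (δ : ℝ) : Prop :=
  ∃ (R : Type) (_ : Fintype R) (_ : Nonempty R) (Q : R → Bits ℕ → Set ℕ),
    (∀ r, SelfDetermined (Q r)) ∧ (∀ r y y', AgreeOn (Q r y) y y' → F y = F y') ∧
      ∀ t < M, 𝔼 r, 𝔼 x : Bits (Fin N), ind (Touches (Q r (rows g k (extendBits x))) t) ≤ δ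

/-- Replace each queried node of the upper row by a set of nodes of the lower row. -/
def refineRule (Φ : Bits ℕ → Bits ℕ) (A : ℕ → Bits ℕ → Set ℕ) (Q : Bits ℕ → Set ℕ) :
    Bits ℕ → Set ℕ := fun y => ⋃ J ∈ Q (Φ y), A J y

section Refine

variable {Φ : Bits ℕ → Bits ℕ} {A : ℕ → Bits ℕ → Set ℕ} {Q : Bits ℕ → Set ℕ}
  (hA : ∀ J, SelfDetermined (A J)) (hΦ : ∀ J y y', AgreeOn (A J y) y y' → Φ y J = Φ y' J)

include hΦ

theorem agreeOn_of_refineRule {y y' : Bits ℕ} (h : AgreeOn (refineRule Φ A Q y) y y') :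
    AgreeOn (Q (Φ y)) (Φ y) (Φ y') := fun J hJ =>
  hΦ J y y' fun i hi => h i (Set.mem_biUnion hJ hi)

include hA

/-- The lower nodes that are read determine the upper values on which the upper rule relies, so the
upper queried set is recovered first and then each replacement set. -/
theorem SelfDetermined.refineRule (hQ : SelfDetermined Q) : SelfDetermined (refineRule Φ A Q) := by
  intro y y' h
  have e := hQ _ _ (agreeOn_of_refineRule hΦ h)
  unfold NoiseNet.refineRule
  rw [e]
  exact Set.iUnion₂_congr fun J hJ => hA J y y' fun i hi => h i (Set.mem_biUnion hJ hi)

end Refine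

/-- Reading all three children works for any gate and loses nothing: touching block `t` below forces
touching block `t / 2` above. -/
theorem HasQueryRule.convRow {g : ℕ → Gate} {N k : ℕ} {F : Bits ℕ → ℤˣ} {M : ℕ} {δ : ℝ}
    (h : HasQueryRule g N (k + 1) F M δ) :
    HasQueryRule g N k (fun y => F (convRow (g k) y)) (2 * M) δ := by
  obtain ⟨R, _, _, Q, hQ, hF, hδ⟩ := h
  have hΦ : ∀ J (y y' : Bits ℕ), AgreeOn (Set.Icc (2 * J) (2 * J + 2)) y y' →
      NoiseNet.convRow (g k) y J = NoiseNet.convRow (g k) y' J := fun J y y' h => by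
    simp only [NoiseNet.convRow]
    rw [h _ ⟨le_rfl, by omega⟩, h _ ⟨by omega, by omega⟩, h _ ⟨by omega, le_rfl⟩]
  refine ⟨R, ‹_›, ‹_›, fun r => refineRule (NoiseNet.convRow (g k))
    (fun J _ => Set.Icc (2 * J) (2 * J + 2)) (Q r), fun r => ?_, fun r y y' h => ?_, fun t ht => ?_⟩
  · exact SelfDetermined.refineRule (fun J y y' _ => rfl) hΦ (hQ r)
  · exact hF r _ _ (agreeOn_of_refineRule hΦ h)
  · refine le_trans ?_ (hδ (t / 2) (by omega))
    refine expect_le_expect fun r _ => expect_le_expect fun x _ => ind_mono ?_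
    rintro ⟨j, hj, hjt⟩
    obtain ⟨J, hJ, h1, h2⟩ := Set.mem_iUnion₂.1 hj
    exact ⟨J, hJ, by omega⟩

/-- The nodes adjacent to a block with index congruent to `c` modulo `32`. -/
def skipSet (c : ℕ) : Set ℕ := {i | i % 32 = c ∨ (i + 1) % 32 = c}

open Classical in
/-- Query the nodes below node `J` four rows up that are not in `skipSet c`, and the others only if
these do not decide the value. -/
noncomputable def lazyQuery (Φ : Bits ℕ → Bits ℕ) (c J : ℕ) (y : Bits ℕ) : Set ℕ :=
  if ∀ y', AgreeOn (Set.Icc (16 * J) (16 * J + 30) \ skipSet c) y y' → Φ y J = Φ y' J then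
    Set.Icc (16 * J) (16 * J + 30) \ skipSet c
  else Set.Icc (16 * J) (16 * J + 30)

theorem lazyQuery_subset (Φ : Bits ℕ → Bits ℕ) (c J : ℕ) (y : Bits ℕ) :
    lazyQuery Φ c J y ⊆ Set.Icc (16 * J) (16 * J + 30) := by
  unfold lazyQuery
  split_ifs
  · exact Set.sdiff_subset
  · exact subset_rfl

/-- Whether the unskipped nodes suffice is itself visible from what is read: from these nodes alone
if they suffice, and from the full interval otherwise. -/
theorem selfDetermined_lazyQuery {Φ : Bits ℕ → Bits ℕ} (c J : ℕ)
    (hΦ : ∀ y y', AgreeOn (Set.Icc (16 * J) (16 * J + 30)) y y' → Φ y J = Φ y' J) :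
    SelfDetermined (lazyQuery Φ c J) := by
  have aux : ∀ y y', AgreeOn (Set.Icc (16 * J) (16 * J + 30) \ skipSet c) y y' →
      (Φ y J = Φ y' J) →
      (∀ z, AgreeOn (Set.Icc (16 * J) (16 * J + 30) \ skipSet c) y z → Φ y J = Φ z J) →
      ∀ z, AgreeOn (Set.Icc (16 * J) (16 * J + 30) \ skipSet c) y' z → Φ y' J = Φ z J :=
    fun y y' h1 h2 h3 z hz => h2 ▸ h3 z fun i hi => (h1 i hi).trans (hz i hi)
  intro y y' h
  unfold lazyQuery at h ⊢
  split_ifs at h with h1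
  · rw [if_pos h1, if_pos (aux y y' h (h1 y' h) h1)]
  · rw [if_neg h1, if_neg fun h2 => h1 (aux y' y (fun i hi => (h i hi.1).symm) (hΦ y y' h).symm h2)]

theorem lazyQuery_determines {Φ : Bits ℕ → Bits ℕ} (c J : ℕ)
    (hΦ : ∀ y y', AgreeOn (Set.Icc (16 * J) (16 * J + 30)) y y' → Φ y J = Φ y' J)
    (y y' : Bits ℕ) (h : AgreeOn (lazyQuery Φ c J y) y y') : Φ y J = Φ y' J := by
  unfold lazyQuery at h
  split_ifs at h with h1
  · exact h1 y' h
  · exact hΦ y y' h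

/-- If every point of an invariant event can be moved out of a second event by one of finitely many
bijections, the second event covers the first only up to a fixed proportion. -/
theorem expect_ind_le {Ω S : Type*} [Fintype Ω] [Fintype S] [Nonempty S] (φ : S → Ω ≃ Ω)
    (E B : Ω → Prop) (hE : ∀ s x, E x → E (φ s x)) (hB : ∀ x, B x → E x)
    (h : ∀ x, ∃ s, ¬ B (φ s x)) :
    𝔼 x, ind (B x) ≤ (1 - 1 / (Fintype.card S : ℝ)) * 𝔼 x, ind (E x) := by
  have hc : (0 : ℝ) < Fintype.card S := by exact_mod_cast Fintype.card_pos
  have h1 : ∀ x, ind (E x) ≤ ∑ s, (ind (E (φ s x)) - ind (B (φ s x))) := by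
    intro x
    obtain ⟨s, hs⟩ := h x
    have hn : ∀ s, 0 ≤ ind (E (φ s x)) - ind (B (φ s x)) := fun s =>
      sub_nonneg.2 (ind_mono (hB _))
    refine le_trans ?_ (single_le_sum (f := fun s => ind (E (φ s x)) - ind (B (φ s x)))
      (fun s _ => hn s) (mem_univ s))
    have : ind (B (φ s x)) = 0 := if_neg hs
    rw [this, sub_zero]
    exact ind_mono (hE s x)
  have h2 : 𝔼 x, ind (E x) ≤ (Fintype.card S : ℝ) * (𝔼 x, ind (E x) - 𝔼 x, ind (B x)) := by
    refine (expect_le_expect fun x _ => h1 x).trans (le_of_eq ?_)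
    rw [expect_sum_comm]
    have : ∀ s, 𝔼 x, (ind (E (φ s x)) - ind (B (φ s x))) = 𝔼 x, ind (E x) - 𝔼 x, ind (B x) := by
      intro s
      rw [← expect_sub_distrib]
      exact Fintype.expect_equiv (φ s) _ _ fun x => rfl
    simp [this, mul_sub]
  rw [one_sub_mul, one_div, inv_mul_eq_div, le_sub_comm, div_le_iff₀ hc]
  linarith

theorem rows_four_congr {g : ℕ → Gate} (hg : ∀ k, (g k).IsOdd) (J : ℕ) (y y' : Bits ℕ)
    (h : AgreeOn (Set.Icc (16 * J) (16 * J + 30)) y y') : rows g 4 y J = rows g 4 y' J :=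
  (rows_congr hg 4 J fun j h1 h2 => (h j ⟨by omega, by omega⟩).symm).symm

/-- The lazy rule does not touch block `t` if its parent block is aligned. -/
theorem not_touches_lazyQuery {g : ℕ → Gate} (hg : ∀ k, (g k).IsOdd)
    (hreg : ∀ k < 4, (g k).IsRegular) {y : Bits ℕ} {τ : ℤˣ} {J t : ℕ} (ht : 16 * J ≤ t)
    (ht' : t < 16 * J + 16) (hτ : ∀ i < 8, y (16 * J + 2 * i) = τ) (hal : AlignedAt g y J t τ)
    (Q : Bits ℕ → Set ℕ) :
    ¬ Touches (refineRule (rows g 4) (lazyQuery (rows g 4) (t % 32)) Q y) t := by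
  rintro ⟨j, hj, hjt⟩
  obtain ⟨I, -, hI⟩ := Set.mem_iUnion₂.1 hj
  have hI' := lazyQuery_subset _ _ _ _ hI
  have hskip : j ∈ skipSet (t % 32) := by
    rcases hjt with rfl | rfl
    · exact Or.inl rfl
    · exact Or.inr rfl
  have hdet : ∀ y', AgreeOn (Set.Icc (16 * I) (16 * I + 30) \ skipSet (t % 32)) y y' →
      rows g 4 y I = rows g 4 y' I := by
    intro y' hy'
    have hI2 : I = J ∨ I + 1 = J := by
      have := hI'.1; have := hI'.2; omega
    -- The interval meets only the 32 blocks `16 * I, …, 16 * I + 31`, which have distinct residues.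
    -- Hence `t` is the only skipped block in view.
    have hyy : ∀ i, 16 * I ≤ i → i ≤ 16 * I + 30 → i ≠ t → i + 1 ≠ t → y' i = y i := by
      intro i h1 h2 h3 h4
      refine (hy' i ⟨⟨h1, h2⟩, ?_⟩).symm
      rintro (h | h) <;> omega
    rcases hI2 with rfl | hI2
    · exact (rows_four_eq_right hg hreg ht ht' hτ hal hyy).symm
    · exact (rows_four_eq_left hg hreg ht ht' hτ hal hI2 hyy).symm
  rw [lazyQuery, if_pos hdet] at hI
  exact hI.2 hskip

end Query

/-! ### Sign flips and the drop of the touching probability across four regular layers. -/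

section Contraction

open Finset
open scoped BigOperators

/-- A sign pattern that is constant on each of the eight consecutive pairs of level-`k` blocks in
the level-`k + 4` block `J`. -/
def blockSign (k J : ℕ) (s : Fin 8 → ℤˣ) (j : ℕ) : ℤˣ :=
  if h : 8 * J ≤ j / 2 ^ (k + 1) ∧ j / 2 ^ (k + 1) - 8 * J < 8 then s ⟨_, h.2⟩ else 1

/-- Multiplication of a finite bit string by a block sign pattern. -/
def blockFlip (N k J : ℕ) (s : Fin 8 → ℤˣ) : Bits (Fin N) ≃ Bits (Fin N) :=
  Equiv.mulLeft fun j => blockSign k J s j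

theorem extendBits_blockFlip {N : ℕ} (k J : ℕ) (s : Fin 8 → ℤˣ) (x : Bits (Fin N)) {j : ℕ}
    (hj : j < N) : extendBits (blockFlip N k J s x) j = blockSign k J s j * extendBits x j := by
  simp [extendBits, hj, blockFlip]

theorem extendBits_blockFlip_of_outside {N : ℕ} (k J : ℕ) (s : Fin 8 → ℤˣ) (x : Bits (Fin N))
    {j : ℕ} (hj : j < 2 ^ (k + 1) * (8 * J) ∨ 2 ^ (k + 1) * (8 * J + 8) ≤ j) :
    extendBits (blockFlip N k J s x) j = extendBits x j := by
  by_cases hN : j < N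
  · rw [extendBits_blockFlip k J s x hN, blockSign, dif_neg, one_mul]
    rintro ⟨h1, h2⟩
    rcases hj with hj | hj
    · have := Nat.div_lt_of_lt_mul hj
      omega
    · have := (Nat.le_div_iff_mul_le (k := 2 ^ (k + 1)) (x := 8 * J + 8) (y := j) (by positivity)).2
        (by rw [mul_comm]; exact hj)
      omega
  · simp [extendBits, hN]

variable {g : ℕ → Gate} (hg : ∀ k, (g k).IsOdd)
include hg

theorem rows_blockFlip_pair {N k M J : ℕ} (hN : N + 1 = 2 ^ k * (16 * M)) (hJ : J < M)
    (s : Fin 8 → ℤˣ) (x : Bits (Fin N)) (i : Fin 8) :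
    rows g k (extendBits (blockFlip N k J s x)) (16 * J + 2 * i) =
      s i * rows g k (extendBits x) (16 * J + 2 * i) := by
  refine rows_mul hg _ _ _ fun j h1 h2 => ?_
  have hle : 2 ^ k * (16 * J + 2 * i + 2) ≤ 2 ^ k * (16 * M) := Nat.mul_le_mul_left _ (by omega)
  rw [extendBits_blockFlip k J s x (by omega)]
  have e : j / 2 ^ (k + 1) = 8 * J + i := by
    have e1 : 2 ^ k * (16 * J + 2 * (i : ℕ)) = (8 * J + i) * 2 ^ (k + 1) := by ring
    have e2 : 2 ^ k * (16 * J + 2 * (i : ℕ) + 2) = (8 * J + i + 1) * 2 ^ (k + 1) := by ring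
    rw [e1] at h1
    rw [e2] at h2
    exact Nat.div_eq_of_lt_le h1 (by omega)
  have h3 : 8 * J ≤ j / 2 ^ (k + 1) ∧ j / 2 ^ (k + 1) - 8 * J < 8 := by omega
  rw [blockSign, dif_pos h3]
  congr 2
  ext
  simp [e]

theorem rows_blockFlip_of_outside {N k J : ℕ} (s : Fin 8 → ℤˣ) (x : Bits (Fin N)) {m i : ℕ}
    (h : 2 ^ m * (i + 2) ≤ 2 ^ (k + 1) * (8 * J) ∨ 2 ^ (k + 1) * (8 * J + 8) ≤ 2 ^ m * i) :
    rows g m (extendBits (blockFlip N k J s x)) i = rows g m (extendBits x) i :=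
  rows_congr hg m i fun j h1 h2 => extendBits_blockFlip_of_outside k J s x (by omega)

/-- Even nodes have disjoint input cones, so oddness lets each be set to any sign independently. The
neighbours used for alignment lie outside the flipped inputs, so `τ` can be chosen from them
beforehand. -/
theorem exists_blockFlip_aligned {N k M J t : ℕ} (hN : N + 1 = 2 ^ k * (16 * M)) (hJ : J < M)
    (x : Bits (Fin N)) : ∃ s τ,
      (∀ i < 8, rows g k (extendBits (blockFlip N k J s x)) (16 * J + 2 * i) = τ) ∧
      AlignedAt (fun i => g (k + i)) (rows g k (extendBits (blockFlip N k J s x))) J t τ := by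
  set g' : ℕ → Gate := fun i => g (k + i)
  have hg' : ∀ i, (g' i).IsOdd := fun i => hg _
  set y := rows g k (extendBits x)
  -- For `J = 0` the truncated `J - 1` is harmless, as there is no left neighbour to align with.
  set v : ℤˣ := if t < 16 * J + 8 then rows g' 3 y (2 * (J - 1)) else rows g' 3 y (2 * J + 2)
  set τ := v * tripleValue g' 1
  have hτ : tripleValue g' τ = v := by
    have := tripleValue_mul hg' τ 1
    rw [mul_one] at this
    rw [this, mul_assoc, Int.units_mul_self, mul_one]
  have hlow : ∀ s i, i + 2 ≤ 16 * J ∨ 16 * J + 16 ≤ i →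
      rows g k (extendBits (blockFlip N k J s x)) i = y i := by
    intro s i hi
    refine rows_blockFlip_of_outside hg s x ?_
    refine hi.imp (fun h => ?_) fun h => ?_
    · calc 2 ^ k * (i + 2) ≤ 2 ^ k * (16 * J) := Nat.mul_le_mul_left _ h
        _ = _ := by ring
    · calc 2 ^ (k + 1) * (8 * J + 8) = 2 ^ k * (16 * J + 16) := by ring
        _ ≤ _ := Nat.mul_le_mul_left _ h
  refine ⟨fun i => τ * y (16 * J + 2 * i), τ, fun i hi => ?_, ?_⟩
  · have := rows_blockFlip_pair hg hN hJ (fun i => τ * y (16 * J + 2 * i)) x ⟨i, hi⟩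
    rw [this, mul_assoc, Int.units_mul_self, mul_one]
  · rw [AlignedAt, hτ]
    rcases lt_or_ge t (16 * J + 8) with ht | ht
    · refine Or.inl ⟨ht, fun J' hJ' => ?_⟩
      have e : J - 1 = J' := by omega
      simp only [v, if_pos ht, e]
      exact rows_congr hg' 3 _ fun j h1 h2 => hlow _ j (by omega)
    · refine Or.inr ⟨ht, ?_⟩
      simp only [v, if_neg (not_lt.2 ht)]
      exact rows_congr hg' 3 _ fun j h1 h2 => hlow _ j (by omega)

/-- The flip changes inputs of block `J` only. If the rule did not touch that block after the flip,
it read only nodes that do not see the change, so by self-determination it made the same queries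
before. -/
theorem touches_blockFlip {N k J : ℕ} {Q : Bits ℕ → Set ℕ} (hQ : SelfDetermined Q)
    (s : Fin 8 → ℤˣ) (x : Bits (Fin N)) (h : Touches (Q (rows g (k + 4) (extendBits x))) J) :
    Touches (Q (rows g (k + 4) (extendBits (blockFlip N k J s x)))) J := by
  by_contra hc
  have := hQ _ (rows g (k + 4) (extendBits x)) fun I hI => by
    have h1 : ¬ (I = J ∨ I + 1 = J) := fun h => hc ⟨I, hI, h⟩
    refine rows_blockFlip_of_outside hg s x ?_
    have : I + 2 ≤ J ∨ J + 1 ≤ I := by omega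
    refine this.imp (fun h => ?_) fun h => ?_
    · calc 2 ^ (k + 4) * (I + 2) ≤ 2 ^ (k + 4) * J := Nat.mul_le_mul_left _ h
        _ = _ := by ring
    · calc 2 ^ (k + 1) * (8 * J + 8) = 2 ^ (k + 4) * (J + 1) := by ring
        _ ≤ _ := Nat.mul_le_mul_left _ h
  rw [this] at h
  exact hc h

/-- The residue of `t` is drawn with probability `1/32`, and then alignment saves a proportion
`1/256` of the event that the parent block is touched. Other residues do no harm, since touching `t`
always requires touching its parent. -/
theorem HasQueryRule.regular {N k M : ℕ} {F : Bits ℕ → ℤˣ} {δ : ℝ}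
    (h : HasQueryRule g N (k + 4) F M δ) (hN : N + 1 = 2 ^ k * (16 * M))
    (hreg : ∀ i < 4, (g (k + i)).IsRegular) :
    HasQueryRule g N k (fun y => F (rows (fun i => g (k + i)) 4 y)) (16 * M)
      ((1 - 1 / 8192) * δ) := by
  obtain ⟨R, _, _, Q, hQ, hF, hδ⟩ := h
  set g' : ℕ → Gate := fun i => g (k + i)
  have hg' : ∀ i, (g' i).IsOdd := fun i => hg _
  have hcong := rows_four_congr hg'
  refine ⟨Fin 32 × R, inferInstance, inferInstance,
    fun cr => refineRule (rows g' 4) (lazyQuery (rows g' 4) cr.1) (Q cr.2),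
    fun cr => SelfDetermined.refineRule (fun J => selfDetermined_lazyQuery _ J (hcong J))
      (fun J => lazyQuery_determines _ J (hcong J)) (hQ cr.2),
    fun cr y y' h => hF cr.2 _ _ (agreeOn_of_refineRule
      (fun J => lazyQuery_determines _ J (hcong J)) h), fun t ht => ?_⟩
  set e : R → ℝ := fun r =>
    𝔼 x : Bits (Fin N), ind (Touches (Q r (rows g (k + 4) (extendBits x))) (t / 16))
  have hparent : ∀ (c : Fin 32) r (x : Bits (Fin N)),
      Touches (refineRule (rows g' 4) (lazyQuery (rows g' 4) c) (Q r) (rows g k (extendBits x))) t →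
      Touches (Q r (rows g (k + 4) (extendBits x))) (t / 16) := by
    rintro c r x ⟨j, hj, hjt⟩
    obtain ⟨I, hI, hI'⟩ := Set.mem_iUnion₂.1 hj
    obtain ⟨h1, h2⟩ := Set.mem_Icc.1 (lazyQuery_subset _ _ _ _ hI')
    exact ⟨I, hI, by omega⟩
  have hle : ∀ (c : Fin 32) r, 𝔼 x : Bits (Fin N),
      ind (Touches (refineRule (rows g' 4) (lazyQuery (rows g' 4) c) (Q r)
        (rows g k (extendBits x))) t) ≤ e r := fun c r =>
    expect_le_expect fun x _ => ind_mono (hparent c r x)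
  have hlt : ∀ r, 𝔼 x : Bits (Fin N),
      ind (Touches (refineRule (rows g' 4) (lazyQuery (rows g' 4) (⟨t % 32, by omega⟩ : Fin 32))
        (Q r) (rows g k (extendBits x))) t) ≤ (1 - 1 / 256) * e r := by
    intro r
    have := expect_ind_le (blockFlip N k (t / 16))
      (fun x => Touches (Q r (rows g (k + 4) (extendBits x))) (t / 16))
      (fun x => Touches (refineRule (rows g' 4) (lazyQuery (rows g' 4) (t % 32)) (Q r)
        (rows g k (extendBits x))) t)
      (fun s x => touches_blockFlip hg (hQ r) s x) (hparent ⟨t % 32, by omega⟩ r) (fun x => by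
        obtain ⟨s, τ, hs, hal⟩ := exists_blockFlip_aligned hg (t := t) hN
          (show t / 16 < M by omega) x
        exact ⟨s, not_touches_lazyQuery hg' hreg (by omega) (by omega) hs hal _⟩)
    have hcard : (Fintype.card (Fin 8 → ℤˣ) : ℝ) = 256 := by
      simp
    rw [hcard] at this
    exact this
  calc _ = 𝔼 r, 𝔼 c : Fin 32, 𝔼 x : Bits (Fin N),
      ind (Touches (refineRule (rows g' 4) (lazyQuery (rows g' 4) c) (Q r)
        (rows g k (extendBits x))) t) := by
        rw [← univ_product_univ, expect_product, expect_comm]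
    _ ≤ 𝔼 r, (1 - 1 / 8192) * e r := by
        refine expect_le_expect fun r _ => ?_
        -- One residue gains the factor `1 - 1/256`, while the other 31 use the trivial bound.
        rw [Fintype.expect_eq_sum_div_card, ← add_sum_erase _ _
          (mem_univ (⟨t % 32, by omega⟩ : Fin 32))]
        have h1 := sum_le_sum fun c (_ : c ∈ univ.erase (⟨t % 32, by omega⟩ : Fin 32)) => hle c r
        have h2 := hlt r
        rw [sum_const, card_erase_of_mem (mem_univ _), card_univ, Fintype.card_fin,
          nsmul_eq_mul] at h1
        rw [Fintype.card_fin, div_le_iff₀ (by norm_num)]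
        push_cast at h1 ⊢
        linarith
    _ = (1 - 1 / 8192) * 𝔼 r, e r := by rw [mul_expect]
    _ ≤ _ := by
        exact mul_le_mul_of_nonneg_left (hδ _ (by omega)) (by norm_num)

end Contraction

/-! ### Iterating over windows and bounding the covariance for fixed gates. -/

section Revealment

open Finset
open scoped BigOperators

/-- Row `k` of a network of depth `n` has a query rule for the output node with touching probability
at most `δ`. -/
def OutputQueryRule (g : ℕ → Gate) (n k : ℕ) (δ : ℝ) : Prop :=
  ∃ F, HasQueryRule g (2 ^ (n + 1) - 1) k F (2 ^ (n - k + 1)) δ ∧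
    ∀ x, F (rows g k x) = rows g n x 0

theorem outputQueryRule_self (g : ℕ → Gate) (n : ℕ) : OutputQueryRule g n n 1 := by
  refine ⟨fun y => y 0, ⟨Unit, inferInstance, inferInstance, fun _ _ => {0}, fun _ _ _ _ => rfl,
    fun _ y y' h => h 0 rfl, fun t _ => ?_⟩, fun _ => rfl⟩
  calc _ ≤ 𝔼 _r : Unit, 𝔼 _x : Bits (Fin (2 ^ (n + 1) - 1)), (1 : ℝ) :=
        expect_le_expect fun r _ => expect_le_expect fun x _ => ind_le_one _
    _ = 1 := by simp

theorem OutputQueryRule.pred {g : ℕ → Gate} {n k : ℕ} {δ : ℝ} (hk : k + 1 ≤ n)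
    (h : OutputQueryRule g n (k + 1) δ) : OutputQueryRule g n k δ := by
  obtain ⟨F, h1, h2⟩ := h
  refine ⟨fun y => F (convRow (g k) y), ?_, fun x => h2 x⟩
  have e : 2 ^ (n - k + 1) = 2 * 2 ^ (n - (k + 1) + 1) := by
    rw [← pow_succ']; congr 1; omega
  rw [e]
  exact h1.convRow

theorem OutputQueryRule.regular {g : ℕ → Gate} (hg : ∀ k, (g k).IsOdd) {n k : ℕ} {δ : ℝ}
    (hk : k + 4 ≤ n) (hreg : ∀ i < 4, (g (k + i)).IsRegular)
    (h : OutputQueryRule g n (k + 4) δ) : OutputQueryRule g n k ((1 - 1 / 8192) * δ) := by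
  obtain ⟨F, h1, h2⟩ := h
  refine ⟨fun y => F (rows (fun i => g (k + i)) 4 y), ?_, fun x => h2 x⟩
  have e : 2 ^ (n - k + 1) = 16 * 2 ^ (n - (k + 4) + 1) := by
    rw [show 16 = 2 ^ 4 by norm_num, ← pow_add]; congr 1; omega
  rw [e]
  refine h1.regular hg ?_ hreg
  rw [← e, ← pow_add, Nat.sub_add_cancel Nat.one_le_two_pow]
  congr 1; omega

open Classical in
/-- The factor by which the touching probability drops across the window of the four layers
`4 t, …, 4 t + 3`. -/
noncomputable def windowFactor (g : ℕ → Gate) (t : ℕ) : ℝ :=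
  if ∀ i < 4, (g (4 * t + i)).IsRegular then 1 - 1 / 8192 else 1

theorem outputQueryRule_windows {g : ℕ → Gate} (hg : ∀ k, (g k).IsOdd) (n m : ℕ) (hm : m ≤ n / 4) :
    OutputQueryRule g n (4 * (n / 4 - m)) (∏ t ∈ Ico (n / 4 - m) (n / 4), windowFactor g t) := by
  induction m with
  | zero =>
    simp only [Nat.sub_zero, Ico_self, prod_empty]
    -- The top `n % 4` layers belong to no complete window and are crossed without gain.
    have key : ∀ r ≤ n, OutputQueryRule g n (n - r) 1 := by
      intro r
      induction r with
      | zero => exact fun _ => outputQueryRule_self g n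
      | succ r ih =>
        intro hr
        refine OutputQueryRule.pred (by omega) ?_
        rw [show n - (r + 1) + 1 = n - r by omega]
        exact ih (by omega)
    rw [show 4 * (n / 4) = n - n % 4 by omega]
    exact key _ (Nat.mod_le _ _)
  | succ m ih =>
    have ih := ih (by omega)
    set t := n / 4 - (m + 1)
    have et : n / 4 - m = t + 1 := by omega
    rw [et] at ih
    rw [prod_eq_prod_Ico_succ_bot (by omega)]
    rw [show 4 * (t + 1) = 4 * t + 4 by ring] at ih
    unfold windowFactor
    split_ifs with h
    · exact ih.regular hg (by omega) h
    · rw [one_mul]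
      exact (((ih.pred (by omega)).pred (by omega)).pred (by omega)).pred (by omega)

theorem windowFactor_nonneg (g : ℕ → Gate) (t : ℕ) : 0 ≤ windowFactor g t := by
  unfold windowFactor; split_ifs <;> norm_num

/-- In row 0 a queried bit touches the block with its own index, so the touching bound is a
revealment bound. Padding bits are constant and need not be read. -/
theorem noiseCov_rows_le {g : ℕ → Gate} (hg : ∀ k, (g k).IsOdd) (n : ℕ) {ε : ℝ} (h0 : 0 < ε)
    (h1 : ε ≤ 1 / 2) :
    noiseCov (fun x : Bits (Layer n) => rows g n (extendBits x) 0) ε ≤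
      (∏ t ∈ range (n / 4), windowFactor g t) / ε ^ 2 := by
  obtain ⟨F, ⟨R, _, _, Q, hQ, hF, hδ⟩, hFg⟩ := outputQueryRule_windows hg n (n / 4) le_rfl
  rw [Nat.sub_self, ← range_eq_Ico] at hδ
  simp only [Nat.sub_self, mul_zero, rows, Nat.sub_zero] at hδ hFg
  have hagree : ∀ r (x y : Bits (Layer n)), (∀ i : Layer n, (i : ℕ) ∈ Q r (extendBits x) →
      x i = y i) → AgreeOn (Q r (extendBits x)) (extendBits x) (extendBits y) := by
    intro r x y h i hi
    by_cases hN : i < 2 ^ (n + 1) - 1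
    · simp only [extendBits, hN, dif_pos]
      exact h ⟨i, hN⟩ hi
    · simp [extendBits, hN]
  have hpos : 0 ≤ ∏ t ∈ range (n / 4), windowFactor g t :=
    prod_nonneg fun t _ => windowFactor_nonneg g t
  refine noiseCov_le h0 h1 _ hpos fun d hd => levelWeight_le
    (fun r (x : Bits (Layer n)) => {i | (i : ℕ) ∈ Q r (extendBits x)}) (fun r x y h => ?_) _
    (fun x => abs_bitVal _) (fun r x y h => ?_) hpos (fun i => ?_) hd
  · change {i : Layer n | _} = {i : Layer n | _}
    rw [hQ r _ _ (hagree r x y h)]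
  · rw [← hFg, ← hFg, hF r _ _ (hagree r x y h)]
  · refine le_trans ?_ (hδ i (by have := i.2; omega))
    refine expect_le_expect fun r _ => expect_le_expect fun x _ => ?_
    exact ind_mono (q := Touches _ _) fun h => ⟨i, h, Or.inl rfl⟩

end Revealment

section Network

/-! ### Networks as rows -/

/-- The gate expressed by a filter. -/
noncomputable def filterGate (θ : Fin 3 → ℝ) : Gate := fun a b c => weightedMaj θ ![a, b, c]

theorem sgn_neg {z : ℝ} (hz : z ≠ 0) : sgn (-z) = -sgn z := by
  unfold sgn
  rcases hz.lt_or_gt with h | h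
  · simp [h.le, not_le.2 h]
  · simp [h.le, not_le.2 h]

theorem filterGate_isOdd {θ : Fin 3 → ℝ} (hθ : NoTies θ) : (filterGate θ).IsOdd := by
  intro s a b c
  rcases Int.units_eq_one_or s with rfl | rfl
  · simp
  · have : preact θ ![-1 * a, -1 * b, -1 * c] = -preact θ ![a, b, c] := by
      simp only [preact, Fin.sum_univ_three, Matrix.cons_val, neg_one_mul, bitVal_neg]
      ring
    rw [filterGate, weightedMaj, this, sgn_neg (hθ _), neg_one_mul]
    rfl

theorem maj3_isRegular (a x : ℤˣ) :
    maj3 ![a, a, x] = a ∧ maj3 ![a, x, a] = a ∧ maj3 ![x, a, a] = a := by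
  rcases Int.units_eq_one_or a with rfl | rfl <;> rcases Int.units_eq_one_or x with rfl | rfl <;>
    simp [maj3, weightedMaj, preact, Fin.sum_univ_three, sgn, bitVal] <;> norm_num

theorem filterGate_isRegular {θ : Fin 3 → ℝ} (hθ : ExpressesMajority θ) :
    (filterGate θ).IsRegular := by
  intro a x
  have h := maj3_isRegular a x
  have h' := maj3_isRegular a a
  rcases hθ with hθ | hθ <;> simp only [filterGate, hθ, h.1, h.2.1, h.2.2, h'.1, and_self]

theorem noTies_one : NoTies fun _ => 1 := by
  intro x
  rcases Int.units_eq_one_or (x 0) with h0 | h0 <;> rcases Int.units_eq_one_or (x 1) with h1 | h1 <;>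
    rcases Int.units_eq_one_or (x 2) with h2 | h2 <;>
    simp [preact, Fin.sum_univ_three, h0, h1, h2, bitVal] <;> norm_num

/-- The gates of a network, completed by majorities above the output. -/
noncomputable def networkGates (n : ℕ) (θ : Fin n → Fin 3 → ℝ) (k : ℕ) : Gate :=
  filterGate (if h : k < n then θ ⟨k, h⟩ else fun _ => 1)

theorem networkGates_isOdd {n : ℕ} {θ : Fin n → Fin 3 → ℝ} (hθ : ∀ t, NoTies (θ t)) (k : ℕ) :
    (networkGates n θ k).IsOdd := by
  unfold networkGates
  split_ifs
  · exact filterGate_isOdd (hθ _)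
  · exact filterGate_isOdd noTies_one

theorem rows_succ_bot (g : ℕ → Gate) (n : ℕ) (x : Bits ℕ) :
    rows g (n + 1) x = rows (fun k => g (k + 1)) n (convRow (g 0) x) := by
  induction n with
  | zero => rfl
  | succ n ih => rw [rows, ih]; rfl

theorem network_eq_rows (n : ℕ) (θ : Fin n → Fin 3 → ℝ) (hθ : ∀ t, NoTies (θ t))
    (ω : Bits (Layer n)) : network n θ ω = rows (networkGates n θ) n (extendBits ω) 0 := by
  induction n with
  | zero => simp [network, rows, extendBits]
  | succ n ih =>
    have hg : (fun k => networkGates (n + 1) θ (k + 1)) = networkGates n (Fin.tail θ) := by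
      funext k
      simp only [networkGates, Nat.add_lt_add_iff_right]
      rfl
    have hθ' : ∀ t, NoTies (Fin.tail θ t) := fun t => hθ _
    rw [rows_succ_bot, hg]
    refine (ih _ hθ' _).trans ?_
    -- Padding does not commute with convolution, but the two rows agree on the cone of the output
    -- node.
    refine rows_congr (networkGates_isOdd hθ') n 0 fun j _ hj => ?_
    have hp : 2 ^ (n + 1 + 1) = 2 * 2 ^ (n + 1) := by ring
    have hp' : 2 ^ n * (0 + 2) = 2 ^ (n + 1) := by ring
    have hj' : j < 2 ^ (n + 1) - 1 := by omega
    have h0 : 2 * j < 2 ^ (n + 1 + 1) - 1 := by omega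
    have h1 : 2 * j + 1 < 2 ^ (n + 1 + 1) - 1 := by omega
    have h2 : 2 * j + 2 < 2 ^ (n + 1 + 1) - 1 := by omega
    simp only [extendBits, hj', dif_pos, convRow, networkGates, Nat.succ_pos, h0, h1, h2, filterGate,
      convLayer]
    congr 1
    funext i
    fin_cases i <;> rfl

theorem network_neg (n : ℕ) (θ : Fin n → Fin 3 → ℝ) (hθ : ∀ t, NoTies (θ t))
    (ω : Bits (Layer n)) : network n θ (-ω) = -network n θ ω := by
  rw [network_eq_rows n θ hθ, network_eq_rows n θ hθ,
    rows_mul (networkGates_isOdd hθ) (-1) (x := extendBits ω), neg_one_mul]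
  intro j _ hj
  have hp' : 2 ^ n * (0 + 2) = 2 ^ (n + 1) := by ring
  have hj' : j < 2 ^ (n + 1) - 1 := by omega
  simp [extendBits, hj']

end Network

/-! ### Measurability of the random network and the annealed covariance. -/

section RandomFilters

open Finset
open scoped BigOperators

theorem measurable_weightedMaj : Measurable weightedMaj := by
  have hs : Measurable sgn := Measurable.ite measurableSet_Ici measurable_const measurable_const
  refine measurable_pi_iff.2 fun x => hs.comp ?_
  unfold preact
  fun_prop

theorem measurableSet_expressesMajority : MeasurableSet {θ | ExpressesMajority θ} := by
  have : {θ | ExpressesMajority θ} =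
      weightedMaj ⁻¹' {b | (∀ x, b x = maj3 x) ∨ ∀ x, b x = -maj3 x} := rfl
  rw [this]
  exact measurable_weightedMaj .of_discrete

theorem network_congr (n : ℕ) {θ θ' : Fin n → Fin 3 → ℝ}
    (h : ∀ t, weightedMaj (θ t) = weightedMaj (θ' t)) : network n θ = network n θ' := by
  induction n with
  | zero => rfl
  | succ n ih =>
    have h1 : network n (Fin.tail θ) = network n (Fin.tail θ') := ih fun t => h t.succ
    have h2 : convLayer (m := n) (θ 0) = convLayer (θ' 0) := by
      funext x i
      simp only [convLayer, h 0]
    funext ω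
    simp only [network, h1, h2]

/-- The network depends on its weights only through the gates they express, that is, through a
finite discrete space. -/
theorem measurable_network (n : ℕ) : Measurable (network n) := by
  have hW : Measurable fun (θ : Fin n → Fin 3 → ℝ) t => weightedMaj (θ t) :=
    measurable_pi_iff.2 fun t => measurable_weightedMaj.comp (measurable_pi_apply t)
  obtain ⟨G, hG⟩ := (Function.factorsThrough_iff (f := fun (θ : Fin n → Fin 3 → ℝ) t =>
    weightedMaj (θ t)) (network n)).1 fun θ θ' h => network_congr n fun t => congrFun h t
  rw [hG]
  exact (Measurable.of_discrete).comp hW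

variable {ι : Type*} [Fintype ι] [DecidableEq ι]

theorem integral_noisyPair_eq_zero {ε : ℝ} (h0 : 0 ≤ ε) (h1 : ε ≤ 1) (f : BoolFun ι)
    (hf : ∀ x, f (-x) = -f x) : ∫ q, bitVal (f q.1) ∂(noisyPair ι ε) = 0 := by
  have := isProbabilityMeasure_coin h0 h1
  rw [integral_noisyPair h0 h1 fun x _ => bitVal (f x)]
  simp only [integral_const, probReal_univ, one_smul]
  have h : 𝔼 x, bitVal (f x) = 𝔼 x, bitVal (f (-x)) :=
    Fintype.expect_equiv (Equiv.neg _) _ _ fun x => by simp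
  simp only [hf, bitVal_neg, expect_neg_distrib] at h
  linarith

/-- In the law of total covariance the covariance of the conditional means vanishes, because odd
functions have mean zero. -/
theorem annealedNoiseCov_eq_integral {ε : ℝ} (h0 : 0 ≤ ε) (h1 : ε ≤ 1) (π : Measure (BoolFun ι))
    [IsProbabilityMeasure π] (hπ : ∀ᵐ f ∂π, ∀ x, f (-x) = -f x) :
    annealedNoiseCov π ε = ∫ f, noiseCov f ε ∂π := by
  have := isProbabilityMeasure_noisyPair (ι := ι) h0 h1
  have hX : ∫ q, bitVal (q.1 q.2.1) ∂(π.prod (noisyPair ι ε)) = 0 := by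
    rw [integral_prod _ Integrable.of_finite]
    refine integral_eq_zero_of_ae ?_
    filter_upwards [hπ] with f hf
    exact integral_noisyPair_eq_zero h0 h1 f hf
  have hb : ∀ F : BoolFun ι × (Bits ι × Bits ι) → ℤˣ,
      MemLp (fun q => bitVal (F q)) 2 (π.prod (noisyPair ι ε)) := fun F =>
    MemLp.of_bound Measurable.of_discrete.aestronglyMeasurable 1
      (ae_of_all _ fun q => by simp [abs_bitVal])
  have hb' : ∀ F : Bits ι × Bits ι → ℤˣ, MemLp (fun q => bitVal (F q)) 2 (noisyPair ι ε) :=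
    fun F => MemLp.of_bound Measurable.of_discrete.aestronglyMeasurable 1
      (ae_of_all _ fun q => by simp [abs_bitVal])
  rw [annealedNoiseCov, covariance_eq_sub (hb _) (hb _), hX, zero_mul, sub_zero]
  simp only [Pi.mul_apply]
  rw [integral_prod _ Integrable.of_finite]
  refine integral_congr_ae ?_
  filter_upwards [hπ] with f hf
  rw [noiseCov, covariance_eq_sub (hb' _) (hb' _), integral_noisyPair_eq_zero h0 h1 f hf, zero_mul,
    sub_zero]
  rfl

end RandomFilters

/-! ### Independence across disjoint windows. -/

section Windows

open Finset

variable {Ω : Type*} [MeasurableSpace Ω] {P : Measure Ω} [IsProbabilityMeasure P]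
  {E : Type*} [MeasurableSpace E]

theorem integral_prod_windows {ι τ : Type*} [Fintype ι] [DecidableEq ι] [DecidableEq τ]
    {θ : ι → Ω → E} (hθ : ∀ i, Measurable (θ i)) (hind : iIndepFun θ P) {φ : E → ℝ}
    (hφ : Measurable φ) (hφ1 : ∀ e, |φ e| ≤ 1) (c : ℝ) (W : τ → Finset ι) (A : Finset τ)
    (hW : (A : Set τ).PairwiseDisjoint W) :
    ∫ w, ∏ t ∈ A, (1 - c * ∏ i ∈ W t, φ (θ i w)) ∂P =
      ∏ t ∈ A, (1 - c * ∏ i ∈ W t, ∫ w, φ (θ i w) ∂P) := by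
  have hU : ∀ U : Finset ι, ∫ w, ∏ i ∈ U, φ (θ i w) ∂P = ∏ i ∈ U, ∫ w, φ (θ i w) ∂P := by
    intro U
    have := hind.integral_fun_prod_comp (fun i => (hθ i).aemeasurable) (𝕜 := ℝ)
      (f := fun i e => if i ∈ U then φ e else 1) (fun i => by
        split_ifs
        · exact hφ.aestronglyMeasurable
        · exact aestronglyMeasurable_const)
    simp only [prod_ite_mem, univ_inter] at this
    rw [this, ← univ_inter U, ← prod_ite_mem]
    refine prod_congr rfl fun i _ => ?_
    rw [univ_inter]
    split_ifs <;> simp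
  -- Disjoint windows make every monomial of the expansion squarefree, so independence evaluates
  -- each one separately.
  have hexp : ∀ x : ι → ℝ, ∏ t ∈ A, (1 - c * ∏ i ∈ W t, x i) =
      ∑ B ∈ A.powerset, (-c) ^ B.card * ∏ i ∈ B.biUnion W, x i := by
    intro x
    simp only [sub_eq_add_neg, ← neg_mul]
    rw [prod_one_add]
    refine sum_congr rfl fun B hB => ?_
    rw [prod_mul_distrib, prod_const, prod_biUnion]
    exact hW.subset (coe_subset.2 (mem_powerset.1 hB))
  simp only [hexp fun i => φ (θ i _), hexp fun i => ∫ w, φ (θ i w) ∂P]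
  rw [integral_finsetSum]
  · simp only [integral_const_mul, hU]
  · intro B _
    refine Integrable.const_mul ?_ _
    refine Integrable.of_bound (C := 1) ?_ (ae_of_all _ fun w => ?_)
    · exact (Finset.measurable_fun_prod _ fun i _ => hφ.comp (hθ i)).aestronglyMeasurable
    · rw [Real.norm_eq_abs, abs_prod]
      exact prod_le_one (fun _ _ => abs_nonneg _) fun i _ => hφ1 _

end Windows

/-! ### The expected noise covariance of the random network. -/

section Main

open Finset

/-- The four layers of the `t`-th window. -/
def window (n t : ℕ) : Finset (Fin n) := {i | (i : ℕ) / 4 = t}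

theorem card_window_le (n t : ℕ) : (window n t).card ≤ 4 := by
  have : (window n t).card ≤ (Ico (4 * t) (4 * t + 4)).card :=
    card_le_card_of_injOn (fun i => (i : ℕ)) (fun i hi => by
      have : (i : ℕ) / 4 = t := by simpa [window] using hi
      simp only [coe_Ico, Set.mem_Ico]
      omega) (fun i _ j _ h => Fin.ext h)
  simpa using this

theorem pairwiseDisjoint_window (n : ℕ) (A : Set ℕ) : A.PairwiseDisjoint (window n) := by
  intro s _ t _ hst
  refine Finset.disjoint_left.2 fun i hi hj => hst ?_
  simp only [window, mem_filter, mem_univ, true_and] at hi hj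
  exact hi.symm.trans hj

theorem windowFactor_le {n : ℕ} (θ : Fin n → Fin 3 → ℝ) {t : ℕ} (ht : t < n / 4) :
    windowFactor (networkGates n θ) t ≤
      1 - 1 / 8192 * ∏ i ∈ window n t, ind (ExpressesMajority (θ i)) := by
  by_cases h : ∀ i ∈ window n t, ExpressesMajority (θ i)
  · rw [windowFactor, if_pos, prod_eq_one fun i hi => ind_of_true (h i hi), mul_one]
    intro i hi
    have hlt : 4 * t + i < n := by omega
    rw [networkGates, dif_pos hlt]
    refine filterGate_isRegular (h _ ?_)
    simp only [window, mem_filter, mem_univ, true_and]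
    omega
  · push Not at h
    obtain ⟨i, hi, hi'⟩ := h
    have h0 : ind (ExpressesMajority (θ i)) = 0 := if_neg hi'
    rw [prod_eq_zero hi h0, windowFactor]
    split_ifs <;> norm_num

variable {Ω : Type*} [MeasurableSpace Ω] {P : Measure Ω} [IsProbabilityMeasure P] {n : ℕ}
  {θ : Fin n → Ω → Fin 3 → ℝ}

theorem measurable_ind_expressesMajority : Measurable fun θ => ind (ExpressesMajority θ) := by
  unfold ind
  exact Measurable.ite measurableSet_expressesMajority measurable_const measurable_const

theorem integral_windows_le (hmeas : ∀ t, Measurable (θ t)) (hindep : iIndepFun θ P) {p : ℝ}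
    (hp : 0 < p) (hmaj : ∀ t, p ≤ P.real {w | ExpressesMajority (θ t w)}) :
    ∫ w, ∏ t ∈ range (n / 4),
        (1 - 1 / 8192 * ∏ i ∈ window n t, ind (ExpressesMajority (θ i w))) ∂P ≤
      (1 - 1 / 8192 * p ^ 4) ^ (n / 4) := by
  rw [integral_prod_windows hmeas hindep measurable_ind_expressesMajority
    (fun e => abs_le.2 ⟨by linarith [ind_nonneg (ExpressesMajority e)], ind_le_one _⟩) _ _ _
    (pairwiseDisjoint_window n _)]
  have hint : ∀ i, ∫ w, ind (ExpressesMajority (θ i w)) ∂P =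
      P.real {w | ExpressesMajority (θ i w)} := by
    intro i
    refine Eq.trans ?_ (integral_indicator_one (hmeas i measurableSet_expressesMajority))
    refine integral_congr_ae (ae_of_all _ fun w => ?_)
    by_cases h : ExpressesMajority (θ i w)
    · exact (ind_of_true h).trans
        (Set.indicator_of_mem (s := {w | ExpressesMajority (θ i w)}) h 1).symm
    · exact (if_neg h).trans
        (Set.indicator_of_notMem (s := {w | ExpressesMajority (θ i w)}) h 1).symm
  simp only [hint]
  rw [← card_range (n / 4), ← prod_const, card_range]
  refine prod_le_prod (fun t _ => ?_) fun t ht => ?_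
  · have : ∏ i ∈ window n t, P.real {w | ExpressesMajority (θ i w)} ≤ 1 :=
      prod_le_one (fun _ _ => measureReal_nonneg) fun _ _ => measureReal_le_one
    linarith
  · have hn : 0 < n := by have := mem_range.1 ht; omega
    have hp1 : p ≤ 1 := (hmaj ⟨0, hn⟩).trans measureReal_le_one
    have h1 : p ^ 4 ≤ p ^ (window n t).card := pow_le_pow_of_le_one hp.le hp1 (card_window_le n t)
    have h2 : p ^ (window n t).card ≤
        ∏ i ∈ window n t, P.real {w | ExpressesMajority (θ i w)} := by
      rw [← prod_const]
      exact prod_le_prod (fun _ _ => hp.le) fun i _ => hmaj i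
    linarith

theorem integral_noiseCov_network_le (hmeas : ∀ t, Measurable (θ t)) (hindep : iIndepFun θ P)
    (hties : ∀ t, ∀ᵐ w ∂P, NoTies (θ t w)) {p : ℝ} (hp : 0 < p)
    (hmaj : ∀ t, p ≤ P.real {w | ExpressesMajority (θ t w)}) {ε : ℝ} (h0 : 0 < ε)
    (h1 : ε ≤ 1 / 2) :
    ∫ f, noiseCov f ε ∂(networkLaw P n θ) ≤ (1 - 1 / 8192 * p ^ 4) ^ (n / 4) / ε ^ 2 := by
  have hm : Measurable fun w => network n fun t => θ t w :=
    (measurable_network n).comp (measurable_pi_iff.2 hmeas)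
  have hnn : ∀ f : BoolFun (Layer n), 0 ≤ noiseCov f ε := noiseCov_nonneg h0.le h1
  rw [networkLaw, integral_map hm.aemeasurable Measurable.of_discrete.aestronglyMeasurable]
  have hmi : ∀ i, Measurable fun w => ind (ExpressesMajority (θ i w)) := fun i =>
    measurable_ind_expressesMajority.comp (hmeas i)
  have hD : ∀ w t, 0 ≤ 1 - 1 / 8192 * ∏ i ∈ window n t, ind (ExpressesMajority (θ i w)) ∧
      1 - 1 / 8192 * ∏ i ∈ window n t, ind (ExpressesMajority (θ i w)) ≤ 1 := by
    intro w t
    have e1 : ∏ i ∈ window n t, ind (ExpressesMajority (θ i w)) ≤ 1 :=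
      prod_le_one (fun _ _ => ind_nonneg _) fun _ _ => ind_le_one _
    have e2 : 0 ≤ ∏ i ∈ window n t, ind (ExpressesMajority (θ i w)) :=
      prod_nonneg fun _ _ => ind_nonneg _
    constructor <;> linarith
  calc ∫ w, noiseCov (network n fun t => θ t w) ε ∂P
      ≤ ∫ w, (∏ t ∈ range (n / 4),
        (1 - 1 / 8192 * ∏ i ∈ window n t, ind (ExpressesMajority (θ i w)))) / ε ^ 2 ∂P := by
        refine integral_mono_of_nonneg (ae_of_all _ fun w => hnn _) ?_ ?_
        · refine (Integrable.of_bound (C := 1) (Measurable.aestronglyMeasurable ?_)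
            (ae_of_all _ fun w => ?_)).div_const _
          · fun_prop
          · rw [Real.norm_of_nonneg (prod_nonneg fun t _ => (hD w t).1)]
            exact prod_le_one (fun t _ => (hD w t).1) fun t _ => (hD w t).2
        · filter_upwards [ae_all_iff.2 hties] with w hw
          have e : network n (fun t => θ t w) = fun x : Bits (Layer n) =>
              rows (networkGates n fun t => θ t w) n (extendBits x) 0 :=
            funext fun x => network_eq_rows n _ hw x
          rw [e]
          refine (noiseCov_rows_le (networkGates_isOdd hw) n h0 h1).trans ?_
          gcongr with t ht
          · exact fun t _ => windowFactor_nonneg _ _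
          · exact windowFactor_le _ (mem_range.1 ht)
    _ ≤ _ := by
        rw [integral_div]
        exact div_le_div_of_nonneg_right (integral_windows_le hmeas hindep hp hmaj) (by positivity)

omit [IsProbabilityMeasure P] in
theorem networkLaw_odd (hmeas : ∀ t, Measurable (θ t)) (hties : ∀ t, ∀ᵐ w ∂P, NoTies (θ t w)) :
    ∀ᵐ f ∂(networkLaw P n θ), ∀ x, f (-x) = -f x := by
  have hm : Measurable fun w => network n fun t => θ t w :=
    (measurable_network n).comp (measurable_pi_iff.2 hmeas)
  rw [networkLaw, ae_map_iff hm.aemeasurable .of_discrete]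
  filter_upwards [ae_all_iff.2 hties] with w hw
  exact network_neg n _ hw

theorem isProbabilityMeasure_networkLaw (hmeas : ∀ t, Measurable (θ t)) :
    IsProbabilityMeasure (networkLaw P n θ) :=
  Measure.isProbabilityMeasure_map
    ((measurable_network n).comp (measurable_pi_iff.2 hmeas)).aemeasurable

end Main

end NoiseNet

theorem mainTheorem10 {Ω : ℕ → Type*} [∀ n, MeasurableSpace (Ω n)]
    (P : ∀ n, Measure (Ω n)) [∀ n, IsProbabilityMeasure (P n)]
    (θ : ∀ n, Fin n → Ω n → Fin 3 → ℝ)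
    (hmeas : ∀ n t, Measurable (θ n t))
    (hindep : ∀ n, iIndepFun (θ n) (P n))
    (hties : ∀ n t, ∀ᵐ w ∂(P n), NoiseNet.NoTies (θ n t w))
    (p : ℝ) (hp : 0 < p)
    (hmaj : ∀ n t, p ≤ (P n).real {w | NoiseNet.ExpressesMajority (θ n t w)}) :
    NoiseNet.QuenchedNoiseSensitive (fun n => NoiseNet.networkLaw (P n) n (θ n)) ∧
      NoiseNet.AnnealedNoiseSensitive (fun n => NoiseNet.networkLaw (P n) n (θ n)) := by
  have hp1 : p ≤ 1 := (hmaj 1 0).trans measureReal_le_one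
  have hprob : ∀ n, IsProbabilityMeasure (NoiseNet.networkLaw (P n) n (θ n)) := fun n =>
    NoiseNet.isProbabilityMeasure_networkLaw (hmeas n)
  have hlim : ∀ ε : ℝ,
      Tendsto (fun n : ℕ => (1 - 1 / 8192 * p ^ 4) ^ (n / 4) / ε ^ 2) atTop (𝓝 0) := by
    intro ε
    have hp4 : p ^ 4 ≤ 1 := pow_le_one₀ hp.le hp1
    have h := (tendsto_pow_atTop_nhds_zero_of_lt_one (r := 1 - 1 / 8192 * p ^ 4) (by linarith)
      (by linarith [pow_pos hp 4])).comp (Nat.tendsto_div_const_atTop (n := 4) (by norm_num))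
    simpa using h.div_const (ε ^ 2)
  have hle := fun n {ε : ℝ} (h0 : 0 < ε) (h1 : ε ≤ 1 / 2) =>
    NoiseNet.integral_noiseCov_network_le (hmeas n) (hindep n) (hties n) hp (hmaj n) h0 h1
  have hnn := fun n {ε : ℝ} (h0 : 0 < ε) (h1 : ε ≤ 1 / 2)
    (f : NoiseNet.BoolFun (NoiseNet.Layer n)) => NoiseNet.noiseCov_nonneg h0.le h1 f
  refine ⟨fun ε h0 h1 δ hδ => ?_, fun ε h0 h1 => ?_⟩
  -- Markov's inequality at level `δ` needs an expectation below `δ * δ` to leave an exceptional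
  -- probability of at most `δ`.
  · obtain ⟨N, hN⟩ := eventually_atTop.1
      ((hlim ε).eventually (gt_mem_nhds (show 0 < δ * δ by positivity)))
    refine ⟨N, fun n hn => ?_⟩
    have := hprob n
    have hM := mul_meas_ge_le_integral_of_nonneg (μ := NoiseNet.networkLaw (P n) n (θ n))
      (ae_of_all _ fun f => hnn n h0 h1 f) Integrable.of_finite δ
    have hsmall : (NoiseNet.networkLaw (P n) n (θ n)).real {f | δ ≤ NoiseNet.noiseCov f ε} ≤ δ :=
      le_of_mul_le_mul_left (hM.trans ((hle n h0 h1).trans (hN n hn).le)) hδ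
    have hcompl := probReal_compl_eq_one_sub (μ := NoiseNet.networkLaw (P n) n (θ n))
      (s := {f | NoiseNet.noiseCov f ε ≤ δ}) .of_discrete
    have hsub : (NoiseNet.networkLaw (P n) n (θ n)).real {f | NoiseNet.noiseCov f ε ≤ δ}ᶜ ≤
        (NoiseNet.networkLaw (P n) n (θ n)).real {f | δ ≤ NoiseNet.noiseCov f ε} :=
      measureReal_mono fun f hf => (not_le.1 (show ¬ NoiseNet.noiseCov f ε ≤ δ from hf)).le
    linarith
  · refine squeeze_zero (fun n => ?_) (fun n => ?_) (hlim ε)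
    · have := hprob n
      rw [NoiseNet.annealedNoiseCov_eq_integral h0.le (by linarith) _
        (NoiseNet.networkLaw_odd (hmeas n) (hties n))]
      exact integral_nonneg fun f => hnn n h0 h1 f
    · have := hprob n
      rw [NoiseNet.annealedNoiseCov_eq_integral h0.le (by linarith) _
        (NoiseNet.networkLaw_odd (hmeas n) (hties n))]
      exact hle n h0 h1
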